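/- **Conventions.** Let $K$ be a field of characteristic zero; graded means $\mathbb Z$-graded. For a graded $K$-vector space $L$ let $L[1]^i=L^{i+1}$, and let $\varepsilon(\sigma)$ denote the Koszul sign of a permutation of homogeneous elements of $L[1]$ (degrees taken in $L[1]$). An *$L_\infty$ algebra* structure on $L$ is a collection of graded symmetric multilinear maps $q_n:L[1]^{\otimes n}\to L[1]$ $(n\ge1)$ of degree $1$ such that for all $n\geq 1$ and homogeneous $a_1,\dots,a_n$ $$\sum_{i=1}^{n}\ \sum_{\sigma\in \mathrm{Sh}(i,n-i)}\varepsilon(\sigma)\,q_{n-i+1}\big(q_i(a_{\sigma(1)},\dots,a_{\sigma(i)}),a_{\sigma(i+1)},\dots,a_{\sigma(n)}\big)=0 ,$$ where $\mathrm{Sh}(i,n-i)$ is the set of $(i,n-i)$-unshuffles; its anti-symmetric brackets $l_n:L^{\otimes n}\to L$, of degree $2-n$, are $l_n(a_1,\dots,a_n)=-(-1)^{\sum_{j}(n-j)(|a_j|-1)}q_n(a_1,\dots,a_n)$, with $|a_j|$ the degree in $L$. An *$L_\infty$ module* over $(L,q)$ is a graded vector space $V$ with multilinear maps $\phi_{n+1}:L[1]^{\otimes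 n}\otimes V\to V$ $(n\ge0)$ of degree $1$, graded symmetric in the first $n$ arguments, such that for all $n\ge 0$, all homogeneous $a_1,\dots,a_n\in L[1]$ and all $v\in V$ $$\sum_{i\ge1}\sum_{\sigma\in \mathrm{Sh}(i,n-i)}\varepsilon(\sigma)\phi_{n-i+2}\big(q_i(a_{\sigma(1)},\dots,a_{\sigma(i)}),a_{\sigma(i+1)},\dots,a_{\sigma(n)},v\big)$$ $$+\sum_{i\ge0}\sum_{\sigma\in \mathrm{Sh}(i,n-i)}(-1)^{\sum_{s\le i}|a_{\sigma(s)}|_{L[1]}}\,\varepsilon(\sigma)\,\phi_{i+1}\big(a_{\sigma(1)},\dots,a_{\sigma(i)},\phi_{n-i+1}(a_{\sigma(i+1)},\dots,a_{\sigma(n)},v)\big)=0 .$$ Its multiplications $m_{n+1}:L^{\otimes n}\otimes V\to V$, of degree $1-n$, are $m_{n+1}(a_1,\dots,a_n,v)=-(-1)^{\sum_{j\le n}(n+1-j)(|a_j|-1)}\phi_{n+1}(a_1,\dots,a_n,v)$. The differentials are $l_1$ and $m_1$. A *morphism* $F:(L,q)\to(L',q')$ of $L_\infty$ algebras is a collection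 of graded symmetric maps $f_n:L[1]^{\otimes n}\to L'[1]$ $(n\ge1)$ of degree $0$ such that, for all $n\ge1$, $$\sum_j q'_j F^j_n(a_1\vee\dots\vee a_n)=\sum_{i=1}^n\sum_{\sigma\in \mathrm{Sh}(i,n-i)}\varepsilon(\sigma)f_{n-i+1}\big(q_i(a_{\sigma(1)},\dots,a_{\sigma(i)}),a_{\sigma(i+1)},\dots,a_{\sigma(n)}\big),$$ where $F^j_n(a_1\vee\dots\vee a_n)$ is $\frac1{j!}$ times the sum, over all ordered partitions of $\{1,\dots,n\}$ into $j$ nonempty blocks $B_1,\dots,B_j$, of $\varepsilon\cdot f_{|B_1|}(a_{B_1})\vee\dots\vee f_{|B_j|}(a_{B_j})$; here $a_B$ lists the $a_p$, $p\in B$, in increasing order of $p$, and $\varepsilon$ is the Koszul sign of the rearrangement. Composition is $(G\circ F)_n=\sum_j g_jF^j_n$, the identity has components $\mathrm{id},0,0,\dots$, and an *isomorphism* is a morphism with a two-sided inverse. If $G:(L',q')\to(L,q)$ is a morphism and $(V,\phi)$ is a module over $(L,q)$, the *induced module structure* on $V$ over $(L',q')$ is $\phi'_{n+1}=\sum_j\phi_{j+1}\circ(G^j_n\otimes\mathrm{id}_V)$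 (with $G^0_0=1$). **Theorem.** Let $M$ be an $L_\infty$ algebra and $V$ an $L_\infty$ module over $M$, both of finite dimension over a field $K$ of characteristic zero, such that - $M^i=0$ and $V^i=0$ for $i\ne0,1$; - the differentials of $M$ and $V$ are zero; - the linear map $\pi:V^0\otimes(V^1)^\vee\to(M^1)^\vee$, $\pi(v\otimes\xi)(a)=\xi(m_2(a\otimes v))$, is injective. Then there exist an $L_\infty$ algebra structure $M'$ on the graded vector space $M$ and an isomorphism of $L_\infty$ algebras $F:M\to M'$ such that for the module structure on $V$ over $M'$ induced along $F^{-1}$, with multiplications $m'_n$, one has $m'_2=m_2$ on $M\otimes V$, and $m'_n:(M^1)^{\otimes(n-1)}\otimes V^0\to V^1$ vanishes for all $n>2$. -/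

import Mathlib

open scoped TensorProduct

noncomputable section

namespace LInfty

/-! ### Koszul signs, graded families of multilinear maps -/

/-- A family `f` of multilinear maps, `f n` taking `n` arguments in `L`. -/
abbrev Family (K L W : Type*) [Field K] [AddCommGroup L] [Module K L]
    [AddCommGroup W] [Module K W] : Type _ :=
  ∀ n : ℕ, MultilinearMap K (fun _ : Fin n => L) W

/-- The Koszul sign of the rearrangement of a word of `n` homogeneous letters, of degrees
`d 0, ..., d (n - 1)`, which sorts the letters by their colour `c`, keeping the order
among letters of the same colour: every pair of letters of degrees `x`, `y` that is
interchanged contributes `(-1) ^ (x * y)`. -/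
def koszulSign {n : ℕ} {α : Type*} [LinearOrder α] (c : Fin n → α) (d : Fin n → ℤ) : ℤˣ :=
  ∏ p : Fin n, ∏ q : Fin n, if p < q ∧ c q < c p then Int.negOnePow (d p * d q) else 1

/-- The Koszul sign of the unshuffle which lists first the letters with position in `S`
and then the remaining ones, both in increasing order. -/
def unshuffleSign {n : ℕ} (S : Finset (Fin n)) (d : Fin n → ℤ) : ℤˣ :=
  koszulSign (fun p => if p ∈ S then (0 : ℕ) else 1) d

/-- The subword of `a` formed by the letters with position in `S`, in increasing order. -/
def subword {L : Type*} {n : ℕ} (S : Finset (Fin n)) (a : Fin n → L) : Fin S.card → L :=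
  fun i => a (S.orderEmbOfFin rfl i)

section Graded

variable {K : Type*} [Field K]
variable {L : Type*} [AddCommGroup L] [Module K L]
variable {L' : Type*} [AddCommGroup L'] [Module K L']
variable {W : Type*} [AddCommGroup W] [Module K W]
variable {V : Type*} [AddCommGroup V] [Module K V]

/-- The graded vector space `L[1]`, with `L[1]^i = L^(i+1)`. -/
def shift (𝓛 : ℤ → Submodule K L) : ℤ → Submodule K L := fun i => 𝓛 (i + 1)

/-- `a 0, ..., a (n - 1)` are homogeneous of degrees `d 0, ..., d (n - 1)`. -/
def IsHomog (𝓐 : ℤ → Submodule K L) {n : ℕ} (d : Fin n → ℤ) (a : Fin n → L) : Prop :=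
  ∀ i, a i ∈ 𝓐 (d i)

/-- Graded symmetry: `f (a_σ(1), ..., a_σ(n)) = ε(σ) f (a_1, ..., a_n)`. In the rearranged
word the letter `p` stands at position `σ⁻¹ p`. -/
def IsGradedSymm (𝓐 : ℤ → Submodule K L) (f : Family K L W) : Prop :=
  ∀ (n : ℕ) (σ : Equiv.Perm (Fin n)) (d : Fin n → ℤ) (a : Fin n → L), IsHomog 𝓐 d a →
    f n (fun i => a (σ i)) = koszulSign (fun p => σ.symm p) d • f n a

/-- All maps of the family have degree `r`. -/
def HasDegree (𝓐 : ℤ → Submodule K L) (𝓑 : ℤ → Submodule K W) (r : ℤ)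
    (f : Family K L W) : Prop :=
  ∀ (n : ℕ) (d : Fin n → ℤ) (a : Fin n → L), IsHomog 𝓐 d a → f n a ∈ 𝓑 (∑ i, d i + r)

/-- For homogeneous `a_1, ..., a_n` of degrees `d`: the sum, over `i ≥ 1` and all
`(i, n-i)`-unshuffles `σ`, of
`ε(σ) f (q (a_σ(1), ..., a_σ(i)), a_σ(i+1), ..., a_σ(n))`.
An unshuffle is encoded by the set `S = {σ(1), ..., σ(i)}`. -/
def insertOp (f : Family K L W) (q : Family K L L) {n : ℕ} (d : Fin n → ℤ) (a : Fin n → L) : W :=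
  ∑ S : Finset (Fin n) with S.Nonempty, unshuffleSign S d •
    f (Sᶜ.card + 1) (Fin.cons (q S.card (subword S a)) (subword Sᶜ a))

/-- For homogeneous `a_1, ..., a_n` of degrees `d`: the value on `a_1 ∨ ... ∨ a_n` of
`∑_j h_j ∘ F^j_n`, where `F` is the morphism of symmetric coalgebras with Taylor coefficients `f`.
Explicitly, it is the sum, over all `j` and all ordered partitions of the
arguments into `j` nonempty blocks, of
`ε / j! * h_j (f (first block), ..., f (last block))`. An ordered partition is encoded by a
surjection `c`. -/
def compOp (h : Family K L' W) (f : Family K L L') {n : ℕ} (d : Fin n → ℤ) (a : Fin n → L) : W :=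
  ∑ j ∈ Finset.range (n + 1), ((j.factorial : K)⁻¹) •
    ∑ c : Fin n → Fin j with Function.Surjective c, koszulSign c d •
      h j (fun i => f _ (subword {p : Fin n | c p = i} a))

/-- For homogeneous `a_1, ..., a_n` of degrees `d`: the endomorphism of `V` which maps `v` to the
sum, over all `0 ≤ i ≤ n` and all `(i, n-i)`-unshuffles `σ`, of
`(-1)^(|a_σ(1)| + ... + |a_σ(i)|) ε(σ) φ (a_σ(1), ..., a_σ(i), ψ (a_σ(i+1), ..., a_σ(n), v))`. -/
def actOp (φ ψ : Family K L (Module.End K V)) {n : ℕ} (d : Fin n → ℤ) (a : Fin n → L) :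
    Module.End K V :=
  ∑ S : Finset (Fin n), (unshuffleSign S d * Int.negOnePow (∑ i ∈ S, d i)) •
    (φ S.card (subword S a) * ψ Sᶜ.card (subword Sᶜ a))

/-- The Taylor coefficients of the identity. -/
def idTaylor {n : ℕ} (a : Fin n → L) : L := if h : n = 1 then a ⟨0, by omega⟩ else 0

/-- The linear map which multiplies `x` of degree `i` in `L` by `(-1) ^ (i - 1)`. -/
def signOp (𝓛 : ℤ → Submodule K L) [DirectSum.Decomposition 𝓛] : L →ₗ[K] L :=
  (DirectSum.toModule K ℤ L fun i => Int.negOnePow (i - 1) • (𝓛 i).subtype) ∘ₗ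
    (DirectSum.decomposeLinearEquiv 𝓛).toLinearMap

theorem signOp_of_mem (𝓛 : ℤ → Submodule K L) [DirectSum.Decomposition 𝓛] {i : ℤ} {x : L}
    (hx : x ∈ 𝓛 i) : signOp 𝓛 x = Int.negOnePow (i - 1) • x := by
  lift x to 𝓛 i using hx
  simp only [signOp, LinearMap.comp_apply, LinearEquiv.coe_coe,
    DirectSum.decomposeLinearEquiv_apply, DirectSum.decompose_coe]
  erw [DirectSum.toModule_lof]
  rfl

end Graded

/-! ### L-infinity algebras and modules, in the graded symmetric formulation on `L[1]` -/

/-- An L-infinity algebra structure on the graded vector space `L = ⨁ 𝓛 i`: graded symmetric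
maps `q n : L[1]^⊗n → L[1]`, `n ≥ 1`, of degree one, satisfying the generalized Jacobi identities.
(`q 0` is not part of the data and is set to zero.) -/
structure LAlgebra {K : Type*} [Field K] {L : Type*} [AddCommGroup L] [Module K L]
    (𝓛 : ℤ → Submodule K L) where
  q : Family K L L
  q_zero : q 0 = 0
  symm : IsGradedSymm (shift 𝓛) q
  degree : HasDegree (shift 𝓛) (shift 𝓛) 1 q
  jacobi : ∀ (n : ℕ) (d : Fin n → ℤ) (a : Fin n → L), IsHomog (shift 𝓛) d a →
    insertOp q q d a = 0

/-- The anti-symmetric brackets `l n : L^⊗n → L` of degree `2 - n`, obtained by décalage: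
`l n (a_1, ..., a_n) = - (-1) ^ (∑_j (n - j) (|a_j| - 1)) q n (a_1, ..., a_n)`. -/
def LAlgebra.l {K : Type*} [Field K] {L : Type*} [AddCommGroup L] [Module K L]
    {𝓛 : ℤ → Submodule K L} [DirectSum.Decomposition 𝓛] (A : LAlgebra 𝓛) : Family K L L :=
  fun n => -(A.q n).compLinearMap (fun j => signOp 𝓛 ^ (j.rev : ℕ))

/-- A morphism of L-infinity algebras: graded symmetric maps `f n : L[1]^⊗n → L'[1]`, `n ≥ 1`, of
degree zero (the Taylor coefficients of a morphism of symmetric coalgebras),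
compatible with the structure maps. -/
structure LHom {K : Type*} [Field K] {L : Type*} [AddCommGroup L] [Module K L]
    {L' : Type*} [AddCommGroup L'] [Module K L']
    {𝓛 : ℤ → Submodule K L} {𝓛' : ℤ → Submodule K L'} (A : LAlgebra 𝓛) (A' : LAlgebra 𝓛') where
  f : Family K L L'
  f_zero : f 0 = 0
  symm : IsGradedSymm (shift 𝓛) f
  degree : HasDegree (shift 𝓛) (shift 𝓛') 0 f
  compat : ∀ (n : ℕ) (d : Fin n → ℤ) (a : Fin n → L), IsHomog (shift 𝓛) d a →
    compOp A'.q f d a = insertOp f A.q d a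

/-- The L-infinity morphisms `F` and `G` are inverse to each other: `G ∘ F = id`
and `F ∘ G = id`. -/
def LHom.IsInverse {K : Type*} [Field K] {L : Type*} [AddCommGroup L] [Module K L]
    {L' : Type*} [AddCommGroup L'] [Module K L']
    {𝓛 : ℤ → Submodule K L} {𝓛' : ℤ → Submodule K L'} {A : LAlgebra 𝓛} {A' : LAlgebra 𝓛'}
    (F : LHom A A') (G : LHom A' A) : Prop :=
  (∀ (n : ℕ) (d : Fin n → ℤ) (a : Fin n → L), IsHomog (shift 𝓛) d a →
    compOp G.f F.f d a = idTaylor a) ∧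
  (∀ (n : ℕ) (d : Fin n → ℤ) (a : Fin n → L'), IsHomog (shift 𝓛') d a →
    compOp F.f G.f d a = idTaylor a)

/-- An L-infinity module structure over `A` on the graded vector space `V = ⨁ 𝓥 i`. The map
`φ n`, which takes `n` arguments in `L[1]` and one argument in `V`, is the structure map usually
written `φ_{n+1} : S^n(L[1]) ⊗ V → V[1]`. The identity `rel` says that the codifferential
on `S(L[1]) ⊗ V` determined by `φ` squares to zero. -/
structure LModule {K : Type*} [Field K] {L : Type*} [AddCommGroup L] [Module K L]
    {𝓛 : ℤ → Submodule K L} (A : LAlgebra 𝓛)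
    {V : Type*} [AddCommGroup V] [Module K V] (𝓥 : ℤ → Submodule K V) where
  φ : Family K L (Module.End K V)
  symm : IsGradedSymm (shift 𝓛) φ
  degree : ∀ (n : ℕ) (d : Fin n → ℤ) (a : Fin n → L), IsHomog (shift 𝓛) d a →
    ∀ (e : ℤ) (v : V), v ∈ 𝓥 e → φ n a v ∈ 𝓥 (∑ i, d i + e + 1)
  rel : ∀ (n : ℕ) (d : Fin n → ℤ) (a : Fin n → L), IsHomog (shift 𝓛) d a →
    insertOp φ A.q d a + actOp φ φ d a = 0

/-- The module multiplications. `B.m n` is the map usually written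
`m_{n+1} : L^⊗n ⊗ V → V`; it has degree `1 - n`, is graded anti-symmetric in the
arguments from `L`, and is obtained by décalage of all `n + 1` arguments:
`m_{n+1} (a_1, ..., a_n, v) =
  - (-1) ^ (∑_{j ≤ n} (n + 1 - j) (|a_j| - 1)) φ_{n+1} (a_1, ..., a_n, v)`. -/
def LModule.m {K : Type*} [Field K] {L : Type*} [AddCommGroup L] [Module K L]
    {𝓛 : ℤ → Submodule K L} [DirectSum.Decomposition 𝓛] {A : LAlgebra 𝓛}
    {V : Type*} [AddCommGroup V] [Module K V] {𝓥 : ℤ → Submodule K V} (B : LModule A 𝓥) :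
    Family K L (Module.End K V) :=
  fun n => -(B.φ n).compLinearMap (fun j => signOp 𝓛 ^ ((j.rev : ℕ) + 1))

/-- `B'` is the module structure on the same graded space induced from `B` along `G : A' → A`,
that is, `φ' = φ ∘ (G ⊗ id)`. -/
def LModule.IsPullback {K : Type*} [Field K] {L : Type*} [AddCommGroup L] [Module K L]
    {L' : Type*} [AddCommGroup L'] [Module K L']
    {𝓛 : ℤ → Submodule K L} {𝓛' : ℤ → Submodule K L'} {A : LAlgebra 𝓛} {A' : LAlgebra 𝓛'}
    {V : Type*} [AddCommGroup V] [Module K V] {𝓥 : ℤ → Submodule K V}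
    (B' : LModule A' 𝓥) (G : LHom A' A) (B : LModule A 𝓥) : Prop :=
  ∀ (n : ℕ) (d : Fin n → ℤ) (a : Fin n → L'), IsHomog (shift 𝓛') d a →
    B'.φ n a = compOp B.φ G.f d a

section Pi

variable {K : Type*} [Field K] {L : Type*} [AddCommGroup L] [Module K L]
variable {𝓛 : ℤ → Submodule K L} [DirectSum.Decomposition 𝓛] {A : LAlgebra 𝓛}
variable {V : Type*} [AddCommGroup V] [Module K V] {𝓥 : ℤ → Submodule K V}

theorem LModule.m_two_mem (B : LModule A 𝓥) (a : 𝓛 1) (v : 𝓥 0) :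
    B.m 1 (fun _ => (a : L)) (v : V) ∈ 𝓥 1 := by
  have h1 : IsHomog (shift 𝓛) (fun _ : Fin 1 => (0 : ℤ)) (fun _ => (a : L)) := fun _ => by
    simp [shift]
  have h := B.degree 1 _ _ h1 0 v v.2
  have hs : signOp 𝓛 (a : L) = a := by rw [signOp_of_mem 𝓛 a.2]; simp
  have : B.m 1 (fun _ => (a : L)) (v : V) = -(B.φ 1 (fun _ => (a : L)) v) := by
    simp [LModule.m, hs]
  rw [this]
  exact Submodule.neg_mem _ (by simpa using h)

/-- The restriction `L^1 → Hom(V^0, V^1)` of `m_2`. -/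
def LModule.mTwo (B : LModule A 𝓥) : 𝓛 1 →ₗ[K] 𝓥 0 →ₗ[K] 𝓥 1 :=
  LinearMap.mk₂ K (fun a v => ⟨B.m 1 (fun _ => (a : L)) (v : V), B.m_two_mem a v⟩)
    (fun a a' v => Subtype.ext (by
      have := (B.m 1).map_update_add (fun _ => 0) 0 (a : L) a'
      simp only [Function.update_eq_const_of_subsingleton] at this
      exact congrArg (fun g => g (v : V)) this))
    (fun r a v => Subtype.ext (by
      have := (B.m 1).map_update_smul (fun _ => 0) 0 r (a : L)
      simp only [Function.update_eq_const_of_subsingleton] at this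
      exact congrArg (fun g => g (v : V)) this))
    (fun a v v' => Subtype.ext (by simp))
    (fun r a v => Subtype.ext (by simp))

/-- The linear map `π : V^0 ⊗ (V^1)^∨ → (L^1)^∨` with
`π (v ⊗ ξ) (a) = ξ (m_2 (a ⊗ v))`. -/
def LModule.pi (B : LModule A 𝓥) : 𝓥 0 ⊗[K] Module.Dual K (𝓥 1) →ₗ[K] Module.Dual K (𝓛 1) :=
  TensorProduct.lift (LinearMap.mk₂ K (fun v ξ => ξ ∘ₗ B.mTwo.flip v)
    (fun v v' ξ => by ext; simp) (fun r v ξ => by ext; simp)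
    (fun v ξ ξ' => by ext; simp) (fun r v ξ => by ext; simp))

end Pi

end LInfty

end

/-! Under the isomorphism between `V^0 ⊗ (V^1)^∨` and `Hom(V^0, V^1)^∨`, which uses finite
dimension, `π` is the dual of the map `M^1 → Hom(V^0, V^1)`, `a ↦ m_2(a, ·)`. Injectivity of `π`
therefore says that this map is surjective (`LModule.mTwo_surjective`), and it has a linear section.
Up to sign this is a map `S` with values in `M^1` such that `φ_2(S T, v) = T v` for `v` in `V^0` and
every `T` carrying `V^0` to `V^1` (`LModule.exists_section`).

Let `F` have linear part the identity and higher coefficients `f_n(a_1, ..., a_n) = S (φ_{n+1}(a_1,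
..., a_n, ·))` on words in `M^1`, zero on all other words of homogeneous letters (`linearizer`). Let
`ψ` be the part of `φ` with at most one argument from `M`. Then `ψ_2(f_n(a_1, ..., a_n), v) =
φ_{n+1}(a_1, ..., a_n, v)` for `v` in `V^0`, so `ψ ∘ F = φ` on words in `M^1` and `V^0`
(`comp_truncateOne_linearizer`). Composing with `F⁻¹` gives `φ ∘ F⁻¹ = ψ` there, which is the
vanishing of the higher `m'_n`. The equality `m'_2 = m_2` holds because the linear part of `F⁻¹` is
the identity.

No compatibility of `F` with brackets has to be checked. A family of symmetric maps of degree zero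
with identity linear part is an invertible coalgebra morphism (`IsUnipotent.exists_inverse`), and
the codifferential and the module structure are transported along it (`exists_transport`).

This formal part is carried out on functions of words of letters (degree, vector). Unshuffles and
partitions are generated recursively by deciding where the first letter goes, so Koszul signs appear
one letter at a time, and blocks ordered by their first letters make the factors `1 / j!` disappear.
The basic facts are coassociativity and cocommutativity of unshuffling, associativity of composition
(`comp_assoc`), and the extension of the morphism relation to arbitrary outer functions
(`insert_comp`). The results are then translated back to families of multilinear maps. -/

noncomputable section

namespace LInfty

/-! ### Words of homogeneous letters and sums over unshuffles -/

/-- A letter is a vector together with its degree. -/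
abbrev Word (L : Type*) := List (ℤ × L)

/-- The total degree of a word. -/
def deg {L : Type*} (w : Word L) : ℤ := (w.map Prod.fst).sum

section Words

variable {L : Type*} {L' : Type*} {W : Type*} [AddCommGroup W] {W' : Type*} [AddCommGroup W']

@[simp] theorem deg_nil : deg ([] : Word L) = 0 := rfl

@[simp] theorem deg_cons (a : ℤ × L) (w : Word L) : deg (a :: w) = a.1 + deg w := by
  simp [deg]

@[simp] theorem deg_append (u v : Word L) : deg (u ++ v) = deg u + deg v := by
  simp [deg]

theorem deg_perm {u v : Word L} (h : u.Perm v) : deg u = deg v :=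
  (h.map _).sum_eq

theorem negOnePow_congr {x y : ℤ} (z : ℤ) (h : x = y + (z + z)) :
    Int.negOnePow x = Int.negOnePow y := by
  rw [Int.negOnePow_eq_iff]
  exact ⟨z, by rw [h]; ring⟩

/-- Induction on the length of a word. -/
theorem word_induction {X : Type*} {P : List X → Prop} (nil : P [])
    (cons : ∀ a w, (∀ t : List X, t.length ≤ w.length → P t) → P (a :: w)) (w : List X) : P w := by
  induction hn : w.length using Nat.strong_induction_on generalizing w with
  | _ n ih =>
    cases w with
    | nil => exact nil
    | cons a w =>
      refine cons a w fun t ht => ih t.length ?_ t rfl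
      simp only [List.length_cons] at hn
      omega

/-- The sum of `Φ s t` over all unshuffles of the word `w` into two subwords `s` and `t`, with
Koszul signs. -/
def splitSum : Word L → (Word L → Word L → W) → W
  | [], Φ => Φ [] []
  | a :: w, Φ => splitSum w (fun s t => Φ (a :: s) t) +
      splitSum w (fun s t => Int.negOnePow (a.1 * deg s) • Φ s (a :: t))

@[simp] theorem splitSum_nil (Φ : Word L → Word L → W) : splitSum [] Φ = Φ [] [] := rfl

theorem splitSum_cons (a : ℤ × L) (w : Word L) (Φ : Word L → Word L → W) :
    splitSum (a :: w) Φ = splitSum w (fun s t => Φ (a :: s) t) +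
      splitSum w (fun s t => Int.negOnePow (a.1 * deg s) • Φ s (a :: t)) := rfl

theorem splitSum_congr {w : Word L} {Φ Ψ : Word L → Word L → W}
    (h : ∀ s t, (s ++ t).Perm w → Φ s t = Ψ s t) : splitSum w Φ = splitSum w Ψ := by
  induction w generalizing Φ Ψ with
  | nil => exact h [] [] (List.Perm.refl _)
  | cons a w ih =>
    rw [splitSum_cons, splitSum_cons]
    congr 1
    · exact ih fun s t hst => h _ _ (by simpa using hst)
    · refine ih fun s t hst => ?_
      rw [h s (a :: t) (List.perm_middle.trans (by simpa using hst))]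

theorem splitSum_add (w : Word L) (Φ Ψ : Word L → Word L → W) :
    splitSum w (fun s t => Φ s t + Ψ s t) = splitSum w Φ + splitSum w Ψ := by
  induction w generalizing Φ Ψ with
  | nil => rfl
  | cons a w ih =>
    simp only [splitSum_cons, smul_add, ih]
    abel

theorem splitSum_map (A : W →+ W') (w : Word L) (Φ : Word L → Word L → W) :
    splitSum w (fun s t => A (Φ s t)) = A (splitSum w Φ) := by
  induction w generalizing Φ with
  | nil => rfl
  | cons a w ih =>
    simp only [splitSum_cons, map_add, ← ih, Units.smul_def, map_zsmul]

theorem splitSum_zero (w : Word L) : splitSum w (fun _ _ => (0 : W)) = 0 :=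
  (splitSum_map (0 : W →+ W) w (fun _ _ => 0)).trans rfl

theorem splitSum_smul {R : Type*} [Monoid R] [DistribMulAction R W] (w : Word L) (c : R)
    (Φ : Word L → Word L → W) :
    splitSum w (fun s t => c • Φ s t) = c • splitSum w Φ :=
  splitSum_map (DistribSMul.toAddMonoidHom W c) w Φ

theorem splitSum_sum {ι : Type*} (I : Finset ι) (w : Word L) (Φ : ι → Word L → Word L → W) :
    splitSum w (fun s t => ∑ i ∈ I, Φ i s t) = ∑ i ∈ I, splitSum w (Φ i) := by
  classical
  induction I using Finset.induction_on with
  | empty => simp [splitSum_zero]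
  | insert i I hi ih => simp only [Finset.sum_insert hi, splitSum_add, ih]

theorem splitSum_apply {X : Type*} (w : Word L) (Φ : Word L → Word L → X → W) (x : X) :
    splitSum w Φ x = splitSum w (fun s t => Φ s t x) :=
  (splitSum_map (Pi.evalAddMonoidHom (fun _ : X => W) x) w Φ).symm

theorem splitSum_eq_zero {w : Word L} {Φ : Word L → Word L → W}
    (h : ∀ s t, (s ++ t).Perm w → Φ s t = 0) : splitSum w Φ = 0 :=
  (splitSum_congr h).trans (splitSum_zero w)

theorem splitSum_left_nil {w : Word L} {Φ : Word L → Word L → W}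
    (h : ∀ s t, s ≠ [] → (s ++ t).Perm w → Φ s t = 0) : splitSum w Φ = Φ [] w := by
  induction w generalizing Φ with
  | nil => rfl
  | cons a w ih =>
    rw [splitSum_cons, splitSum_eq_zero fun s t hst => h _ _ (by simp) (by simpa using hst),
      ih fun s t hs hst => ?_]
    · simp
    · rw [h s (a :: t) hs (List.perm_middle.trans (by simpa using hst)), smul_zero]

theorem splitSum_right_nil {w : Word L} {Φ : Word L → Word L → W}
    (h : ∀ s t, t ≠ [] → (s ++ t).Perm w → Φ s t = 0) : splitSum w Φ = Φ w [] := by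
  induction w generalizing Φ with
  | nil => rfl
  | cons a w ih =>
    rw [splitSum_cons, ih fun s t ht hst => h _ _ ht (by simpa using hst),
      splitSum_eq_zero fun s t hst => ?_, add_zero]
    rw [h s (a :: t) (by simp) (List.perm_middle.trans (by simpa using hst)), smul_zero]

theorem deg_of_append_perm {s t w : Word L} (h : (s ++ t).Perm w) : deg w = deg s + deg t := by
  rw [← deg_perm h, deg_append]

/-- Both sides distribute the letters over three subwords. A letter sent to the third one passes the
first two, and its sign is the product of the two passing signs because degrees add. -/
theorem splitSum_coassoc (w : Word L) (X : Word L → Word L → Word L → W) :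
    splitSum w (fun r t => splitSum r (fun s s' => X s s' t)) =
      splitSum w (fun s r => splitSum r (fun s' t => X s s' t)) := by
  induction w generalizing X with
  | nil => rfl
  | cons a w ih =>
    simp only [splitSum_cons, splitSum_add, ih, smul_add]
    rw [add_assoc]
    congr 1
    congr 1
    · refine splitSum_congr fun s r _ => ?_
      rw [← splitSum_smul]
    · simp only [← splitSum_smul]
      rw [← ih (fun s s' t => Int.negOnePow (a.1 * deg s) • Int.negOnePow (a.1 * deg s') •
        X s s' (a :: t))]
      refine splitSum_congr fun r t _ => splitSum_congr fun s s' hs => ?_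
      rw [deg_of_append_perm hs, mul_add, Int.negOnePow_add, mul_smul]

theorem splitSum_comm (w : Word L) (Φ : Word L → Word L → W) :
    splitSum w Φ = splitSum w (fun s t => Int.negOnePow (deg s * deg t) • Φ t s) := by
  induction w generalizing Φ with
  | nil => simp
  | cons a w ih =>
    rw [splitSum_cons, splitSum_cons, ih, ih (fun s t => _ • Φ s (a :: t)), add_comm]
    congr 1
    · refine splitSum_congr fun s t _ => ?_
      rw [smul_smul, ← Int.negOnePow_add, deg_cons]
      congr 2; ring
    · refine splitSum_congr fun s t _ => ?_
      rw [smul_smul, ← Int.negOnePow_add, deg_cons]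
      congr 1
      exact negOnePow_congr (-(deg s * a.1)) (by ring)

/-- Coassociativity groups the first two subwords together, and cocommutativity exchanges them. This
is the tool for moving a block past another one. -/
theorem splitSum_left_comm (w : Word L) (X : Word L → Word L → Word L → W) :
    splitSum w (fun s r => splitSum r (fun s' t => X s s' t)) =
      splitSum w (fun s' r => splitSum r (fun s t => Int.negOnePow (deg s * deg s') •
        X s s' t)) := by
  rw [← splitSum_coassoc, ← splitSum_coassoc]
  refine splitSum_congr fun r t _ => ?_
  rw [splitSum_comm]
  refine splitSum_congr fun s s' _ => ?_
  rw [mul_comm]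

/-! ### Composition -/

/-- Auxiliary recursion for `comp`. -/
def compAux (f : Word L → L') : ℕ → (Word L' → W) → Word L → W
  | _, h, [] => h []
  -- The first argument is fuel. It does not run out when it is at least the length of the word,
  -- since every block uses a letter.
  | 0, _, _ :: _ => 0
  | n + 1, h, a :: w => splitSum w fun s t =>
      compAux f n (fun u => h ((deg (a :: s), f (a :: s)) :: u)) t

/-- The composition of `h` with the morphism of symmetric coalgebras with Taylor coefficients
`f`, where blocks are ordered by their first letters. -/
def comp (h : Word L' → W) (f : Word L → L') (w : Word L) : W := compAux f w.length h w

theorem compAux_eq_compAux (f : Word L → L') (m k : ℕ) (h : Word L' → W) (w : Word L)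
    (hm : w.length ≤ m) (hk : w.length ≤ k) : compAux f m h w = compAux f k h w := by
  induction m generalizing k h w with
  | zero =>
    cases w with
    | nil => cases k <;> rfl
    | cons a w => simp at hm
  | succ m ih =>
    cases w with
    | nil => cases k <;> rfl
    | cons a w =>
      cases k with
      | zero => simp at hk
      | succ k =>
        refine splitSum_congr fun s t hst => ?_
        have h1 : t.length ≤ w.length := by rw [← hst.length_eq]; simp
        simp only [List.length_cons] at hm hk
        exact ih k _ t (by omega) (by omega)

@[simp] theorem comp_nil (h : Word L' → W) (f : Word L → L') : comp h f [] = h [] := rfl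

theorem comp_cons (h : Word L' → W) (f : Word L → L') (a : ℤ × L) (w : Word L) :
    comp h f (a :: w) = splitSum w fun s t =>
      comp (fun u => h ((deg (a :: s), f (a :: s)) :: u)) f t := by
  conv_lhs => unfold comp
  simp only [List.length_cons, compAux]
  refine splitSum_congr fun s t hst => compAux_eq_compAux _ _ _ _ _ ?_ le_rfl
  rw [← hst.length_eq]; simp

end Words
-- Additivity of composition and its compatibility with unshuffling
section Comp

variable {L L' L'' W W' : Type*} [AddCommGroup W] [AddCommGroup W']

theorem length_right_le {X : Type*} {s t w : List X} (h : (s ++ t).Perm w) :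
    t.length ≤ w.length := by
  rw [← h.length_eq]; simp

theorem length_left_le {X : Type*} {s t w : List X} (h : (s ++ t).Perm w) :
    s.length ≤ w.length := by
  rw [← h.length_eq]; simp

theorem comp_add (h h' : Word L' → W) (f : Word L → L') (w : Word L) :
    comp (fun u => h u + h' u) f w = comp h f w + comp h' f w := by
  induction w using word_induction generalizing h h' with
  | nil => rfl
  | cons a w ih =>
    simp only [comp_cons, ← splitSum_add]
    exact splitSum_congr fun s t hst => ih t (length_right_le hst) _ _

/-- Composition, as a homomorphism in the outer argument. -/
def compHom (f : Word L → L') (w : Word L) : (Word L' → W) →+ W :=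
  AddMonoidHom.mk' (fun h => comp h f w) fun h h' => comp_add h h' f w

@[simp] theorem compHom_apply (f : Word L → L') (w : Word L) (h : Word L' → W) :
    compHom f w h = comp h f w := rfl

theorem comp_zero (f : Word L → L') (w : Word L) : comp (fun _ => (0 : W)) f w = 0 :=
  map_zero (compHom f w)

theorem comp_splitSum_left {X : Type*} (r : Word X) (Φ : Word X → Word X → Word L' → W)
    (f : Word L → L') (w : Word L) :
    comp (fun u => splitSum r (fun s t => Φ s t u)) f w =
      splitSum r (fun s t => comp (Φ s t) f w) := by
  have := splitSum_map (compHom f w) r Φ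
  simp only [compHom_apply] at this
  rw [this]
  congr 1
  funext u
  rw [splitSum_apply]

/-- Additive maps depending on the degree can be pulled out of a composition. -/
theorem comp_map (A : ℤ → W →+ W') (h : Word L' → W) (f : Word L → L') (w : Word L) :
    comp (fun u => A (deg u) (h u)) f w = A (deg w) (comp h f w) := by
  induction w using word_induction generalizing h A with
  | nil => rfl
  | cons a w ih =>
    simp only [comp_cons, ← splitSum_map]
    refine splitSum_congr fun s t hst => ?_
    simp only [deg_cons]
    -- The head block contributes its degree to the word that the map sees, so the induction runs
    -- over all degree-dependent families, here the shifted one.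
    rw [ih t (length_right_le hst) (fun k => A (a.1 + deg s + k)), deg_of_append_perm hst,
      add_assoc]

theorem comp_map_const (A : W →+ W') (h : Word L' → W) (f : Word L → L') (w : Word L) :
    comp (fun u => A (h u)) f w = A (comp h f w) :=
  comp_map (fun _ => A) h f w

theorem comp_smul {R : Type*} [Monoid R] [DistribMulAction R W] (c : R) (h : Word L' → W)
    (f : Word L → L') (w : Word L) : comp (fun u => c • h u) f w = c • comp h f w :=
  comp_map_const (DistribSMul.toAddMonoidHom W c) h f w

theorem comp_smul_deg (c : ℤ → ℤˣ) (h : Word L' → W) (f : Word L → L') (w : Word L) :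
    comp (fun u => c (deg u) • h u) f w = c (deg w) • comp h f w :=
  comp_map (fun k => DistribSMul.toAddMonoidHom W (c k)) h f w

/-- The predicates restrict the comparison to words in selected letters: `P` is inherited by
subwords, and `P'` by the words of values of `f'`. The case of letters of degree zero is the one
needed for the main theorem. -/
theorem comp_congr {P : ℤ × L → Prop} {P' : ℤ × L' → Prop} {h h' : Word L' → W}
    {f f' : Word L → L'} {w : Word L}
    (hf : ∀ s, s ≠ [] → s.length ≤ w.length → (∀ x ∈ s, P x) → f s = f' s ∧ P' (deg s, f' s))
    (hh : ∀ u, u.length ≤ w.length → (∀ x ∈ u, P' x) → h u = h' u) (hw : ∀ x ∈ w, P x) :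
    comp h f w = comp h' f' w := by
  induction w using word_induction generalizing h h' with
  | nil => exact hh [] le_rfl (by simp)
  | cons a w ih =>
    simp only [comp_cons]
    refine splitSum_congr fun s t hst => ?_
    have hs : ∀ x ∈ a :: s, P x := by
      intro x hx
      refine hw x ?_
      rcases List.mem_cons.1 hx with rfl | hx
      · simp
      · exact List.mem_cons_of_mem _ (hst.mem_iff.1 (by simp [hx]))
    have hls := length_left_le hst
    have hlt := length_right_le hst
    obtain ⟨h1, h2⟩ := hf (a :: s) (by simp) (by simpa using hls) hs
    rw [h1]
    refine ih t hlt (fun s' h0 hs' => hf s' h0 (by simp; omega)) (fun u hu hu' => hh _ ?_ ?_) ?_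
    · simp; omega
    · intro x hx
      rcases List.mem_cons.1 hx with rfl | hx
      · exact h2
      · exact hu' x hx
    · exact fun x hx => hw x (List.mem_cons_of_mem _ (hst.mem_iff.1 (by simp [hx])))

theorem comp_congr_length {h h' : Word L' → W} {f : Word L → L'} {w : Word L}
    (hh : ∀ u, u.length ≤ w.length → h u = h' u) : comp h f w = comp h' f w :=
  comp_congr (P := fun _ => True) (P' := fun _ => True) (by simp) (fun u hu _ => hh u hu) (by simp)

theorem comp_eq_zero {h : Word L' → W} {f : Word L → L'} {w : Word L}
    (hh : ∀ u, u.length ≤ w.length → h u = 0) : comp h f w = 0 :=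
  (comp_congr_length hh).trans (comp_zero f w)

/-- Pullback along a morphism of coalgebras is compatible with convolution. -/
theorem comp_splitSum (Φ : Word L' → Word L' → W) (f : Word L → L') (w : Word L) :
    comp (fun u => splitSum u Φ) f w =
      splitSum w (fun s t => comp (fun u => comp (fun v => Φ u v) f t) f s) := by
  induction w using word_induction generalizing Φ with
  | nil => rfl
  | cons a w ih =>
    rw [comp_cons, splitSum_cons]
    simp only [comp_cons _ _ a]
    simp only [splitSum_cons]
    simp only [comp_add, splitSum_add]
    congr 1
    -- The block containing the first letter falls into the left factor.
    · rw [splitSum_coassoc]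
      refine splitSum_congr fun s t hst => ?_
      rw [ih t (length_right_le hst)]
    -- That block falls into the right factor. It has to be moved past the blocks of the left
    -- factor, and of the resulting sign only the contribution of the first letter survives.
    · calc
        _ = splitSum w (fun s' r => splitSum r (fun s t =>
              comp (fun u => comp (fun v => Int.negOnePow (deg (a :: s') * deg u) •
                Φ u ((deg (a :: s'), f (a :: s')) :: v)) f t) f s)) :=
          splitSum_congr fun s' r hr => ih r (length_right_le hr) _
        _ = splitSum w (fun s r => splitSum r (fun s' t =>
              Int.negOnePow (a.1 * deg s) • comp (fun u => comp (fun v =>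
                Φ u ((deg (a :: s'), f (a :: s')) :: v)) f t) f s)) := by
          rw [splitSum_left_comm]
          refine splitSum_congr fun s r _ => splitSum_congr fun s' t _ => ?_
          simp only [comp_smul]
          rw [comp_smul_deg (fun k => Int.negOnePow (deg (a :: s') * k))]
          rw [smul_smul, ← Int.negOnePow_add]
          congr 1
          refine negOnePow_congr (deg s * deg s') ?_
          rw [deg_cons]; ring
        _ = _ := by
          refine splitSum_congr fun s r _ => ?_
          rw [splitSum_smul, comp_splitSum_left]

end Comp
-- Associativity of composition, coderivations and morphisms
section Additive

variable {L L' L'' W : Type*} [AddCommGroup W]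

/-- Additivity of a function of words in every letter. -/
def IsAdditive [AddCommGroup L] (h : Word L → W) : Prop :=
  ∀ u k x y v, h (u ++ (k, x + y) :: v) = h (u ++ (k, x) :: v) + h (u ++ (k, y) :: v)

theorem IsAdditive.cons [AddCommGroup L] {h : Word L → W} (hh : IsAdditive h) (a : ℤ × L) :
    IsAdditive (fun u => h (a :: u)) :=
  fun u => hh (a :: u)

/-- The contraction `x ↦ h (x, ·)`. -/
def IsAdditive.contract [AddCommGroup L] {h : Word L → W} (hh : IsAdditive h) (k : ℤ) :
    L →+ (Word L → W) :=
  AddMonoidHom.mk' (fun x u => h ((k, x) :: u)) fun x y => funext fun u => hh [] k x y u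

theorem IsAdditive.comp_contract [AddCommGroup L'] {h : Word L' → W} (hh : IsAdditive h)
    (f : Word L → L') (k : ℤ) (w : Word L) (r : Word L'') (Φ : Word L'' → Word L'' → L') :
    splitSum r (fun s t => comp (fun u => h ((k, Φ s t) :: u)) f w) =
      comp (fun u => h ((k, splitSum r Φ) :: u)) f w :=
  splitSum_map ((compHom f w).comp (hh.contract k)) r Φ

/-- Associativity of composition. -/
theorem comp_assoc [AddCommGroup L''] {h : Word L'' → W} (hh : IsAdditive h) {g : Word L' → L''}
    (f : Word L → L') (w : Word L) :
    comp (comp h g) f w = comp h (comp g f) w := by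
  induction w using word_induction generalizing h with
  | nil => rfl
  | cons a w ih =>
    simp only [comp_cons h]
    rw [comp_cons]
    simp only [comp_cons h]
    simp only [comp_splitSum]
    -- Now `r`, together with the first letter, collects all letters below one value of `g`: those
    -- in the first block of `f` and those in the other blocks that enter the same value of `g`.
    rw [← splitSum_coassoc]
    refine splitSum_congr fun r t hrt => ?_
    rw [comp_cons g, ← hh.comp_contract]
    refine splitSum_congr fun s t' hst => ?_
    have h1 : ∀ u : Word L', comp (fun v => comp (fun w => h ((deg ((deg (a :: s), f (a :: s)) :: u),
        g ((deg (a :: s), f (a :: s)) :: u)) :: w)) g v) f t =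
        comp (fun w => h ((deg (a :: s) + deg u,
        g ((deg (a :: s), f (a :: s)) :: u)) :: w)) (comp g f) t := fun u => by
      rw [ih t (length_right_le hrt) (hh.cons _), deg_cons]
    simp only [h1]
    -- The degree of the new head letter depends on the inner word, so the contraction of `h` is
    -- pulled out as a degree-dependent additive map.
    have h2 := comp_map (fun k => (compHom (comp g f) t).comp (hh.contract (deg (a :: s) + k)))
      (fun u => g ((deg (a :: s), f (a :: s)) :: u)) f t'
    refine h2.trans ?_
    rw [deg_cons a r, deg_of_append_perm hst, ← add_assoc, ← deg_cons]
    rfl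

/-- The value on `h` of the coderivation of degree one with Taylor coefficients `q`. -/
def insert (h : Word L → W) (q : Word L → L) (w : Word L) : W :=
  splitSum w fun s t => h ((deg s + 1, q s) :: t)

/-- The hypothesis is the morphism relation on Taylor coefficients; the conclusion is the relation
of the full coderivations. The value of `q` is a first letter, so its block is formed from `s`
together with some further letters. Collecting both sets of letters in `r` turns the sum inside this
block into `insert f q r`. -/
theorem insert_comp [AddCommGroup L] [AddCommGroup L'] {h : Word L' → W} (hh : IsAdditive h)
    {f : Word L → L'} {q : Word L → L} {q' : Word L' → L'} (hq : insert f q = comp q' f) (w : Word L) :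
    insert (comp h f) q w = comp (insert h q') f w := by
  have h1 : comp (insert h q') f w = splitSum w fun r t =>
      comp (fun v => h ((deg r + 1, insert f q r) :: v)) f t := by
    unfold insert
    rw [comp_splitSum]
    refine splitSum_congr fun r t _ => ?_
    have h2 := comp_map (fun k => (compHom f t).comp (hh.contract (k + 1))) q' f r
    refine h2.trans ?_
    rw [← hq]; rfl
  rw [h1]
  unfold insert
  simp only [comp_cons]
  rw [← splitSum_coassoc]
  refine splitSum_congr fun r t _ => ?_
  rw [← hh.comp_contract]
  refine splitSum_congr fun s t' hst => ?_
  rw [deg_of_append_perm hst, deg_cons]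
  simp only [add_right_comm]

/-- The swap rule for adjacent letters. -/
def IsSwapSymm (h : Word L → W) : Prop :=
  ∀ u a b v, h (u ++ a :: b :: v) = Int.negOnePow (a.1 * b.1) • h (u ++ b :: a :: v)

theorem IsSwapSymm.cons {h : Word L → W} (hh : IsSwapSymm h) (a : ℤ × L) :
    IsSwapSymm (fun u => h (a :: u)) :=
  fun u => hh (a :: u)

/-- The square of a homological vector field is zero. -/
theorem insert_insert (K : Type*) [Field K] [CharZero K] [Module K W] [AddCommGroup L]
    {h : Word L → W}
    (hh : IsAdditive h) (hs : IsSwapSymm h) {q : Word L → L}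
    (hq : insert q q = fun _ => 0) : insert (insert h q) q = fun _ => 0 := by
  funext w
  -- Nested terms, in which one `q` is applied to the value of the other: these vanish by the Jacobi
  -- identity, by additivity of `h` in its first letter.
  have h1 : splitSum w (fun s t => splitSum t fun s' t' =>
      h ((deg ((deg s + 1, q s) :: s') + 1, q ((deg s + 1, q s) :: s')) :: t')) = 0 := by
    rw [← splitSum_coassoc]
    refine splitSum_eq_zero fun r t hrt => ?_
    have h2 := splitSum_map ((Pi.evalAddMonoidHom (fun _ : Word L => W) t).comp
      (hh.contract (deg r + 1 + 1))) r (fun s s' => q ((deg s + 1, q s) :: s'))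
    refine (splitSum_congr fun s s' hss => ?_).trans (h2.trans ?_)
    · rw [deg_of_append_perm hss, deg_cons, add_right_comm (deg s)]; rfl
    · rw [show splitSum r (fun s s' => q ((deg s + 1, q s) :: s')) = 0 from congrFun hq r, map_zero]
  -- Disjoint terms: exchanging the two insertions, both odd, changes the sign, so the sum equals
  -- its own negative.
  have h2 : splitSum w (fun s t => splitSum t fun s' t' =>
      Int.negOnePow ((deg s + 1) * deg s') •
        h ((deg s' + 1, q s') :: (deg s + 1, q s) :: t')) = 0 := by
    set x := splitSum w (fun s t => splitSum t fun s' t' => Int.negOnePow ((deg s + 1) * deg s') •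
        h ((deg s' + 1, q s') :: (deg s + 1, q s) :: t')) with hx
    have h3 : x = -x := by
      conv_lhs => rw [hx, splitSum_left_comm]
      rw [show -x = Int.negOnePow 1 • x by simp [Units.smul_def], hx, ← splitSum_smul]
      refine splitSum_congr fun s r _ => ?_
      rw [← splitSum_smul]
      refine splitSum_congr fun s' t _ => ?_
      have h5 := hs [] (deg s + 1, q s) (deg s' + 1, q s') t
      simp only [List.nil_append] at h5
      rw [h5]
      simp only [smul_smul, ← Int.negOnePow_add]
      congr 1
      refine negOnePow_congr (deg s' * deg s + deg s) ?_
      ring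
    have h4 : (2 : K) • x = 0 := by
      rw [two_smul]; exact eq_neg_iff_add_eq_zero.1 h3
    exact (smul_eq_zero.1 h4).resolve_left two_ne_zero
  conv_lhs => unfold insert
  simp only [splitSum_cons, splitSum_add]
  rw [h1, h2, add_zero]

end Additive
-- Multilinear functions of words
section Multilinear

variable {K : Type*} [Field K] {L L' W W' : Type*} [AddCommGroup W] [Module K W]

theorem compAux_add {W : Type*} [AddCommGroup W] (f : Word L → L') (n : ℕ)
    (h h' : Word L' → W) (w : Word L) :
    compAux f n (fun u => h u + h' u) w = compAux f n h w + compAux f n h' w := by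
  induction n generalizing h h' w with
  | zero => cases w <;> simp [compAux]
  | succ n ih => cases w with
    | nil => rfl
    | cons a w => simp only [compAux, ih, splitSum_add]

theorem compAux_smul (f : Word L → L') (n : ℕ) (c : K) (h : Word L' → W) (w : Word L) :
    compAux f n (fun u => c • h u) w = c • compAux f n h w := by
  induction n generalizing h w with
  | zero => cases w <;> simp [compAux]
  | succ n ih => cases w with
    | nil => rfl
    | cons a w => simp only [compAux, ih, splitSum_smul]

variable [AddCommGroup L] [Module K L] [AddCommGroup L'] [Module K L'] [AddCommGroup W']
  [Module K W']

/-- The map `x ↦ h x` factors linearly through the projection to the part of degree `k`. -/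
def FactorsThrough (p : ℤ → L →ₗ[K] L) (k : ℤ) (h : L → W) : Prop :=
  ∃ ℓ : L →ₗ[K] W, ∀ x, h x = ℓ (p k x)

namespace FactorsThrough

variable {p : ℤ → L →ₗ[K] L} {k : ℤ}

theorem zero : FactorsThrough p k (fun _ => (0 : W)) := ⟨0, fun _ => rfl⟩

theorem add {h h' : L → W} (h1 : FactorsThrough p k h) (h2 : FactorsThrough p k h') :
    FactorsThrough p k (fun x => h x + h' x) := by
  obtain ⟨ℓ, hl⟩ := h1
  obtain ⟨ℓ', hl'⟩ := h2
  exact ⟨ℓ + ℓ', fun x => by beta_reduce; rw [hl, hl']; rfl⟩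

theorem map {h : L → W} (h1 : FactorsThrough p k h) (A : W →ₗ[K] W') :
    FactorsThrough p k (fun x => A (h x)) := by
  obtain ⟨ℓ, hl⟩ := h1
  exact ⟨A ∘ₗ ℓ, fun x => by beta_reduce; rw [hl]; rfl⟩

theorem units_smul {h : L → W} (h1 : FactorsThrough p k h) (c : ℤˣ) :
    FactorsThrough p k (fun x => c • h x) := by
  obtain ⟨ℓ, hl⟩ := h1
  exact ⟨c • ℓ, fun x => by beta_reduce; rw [hl]; rfl⟩

theorem splitSum {X : Type*} {w : Word X} {Φ : L → Word X → Word X → W}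
    (h : ∀ s t, FactorsThrough p k (fun x => Φ x s t)) :
    FactorsThrough p k (fun x => LInfty.splitSum w (Φ x)) := by
  choose ℓ hl using h
  refine ⟨LInfty.splitSum w ℓ, fun x => ?_⟩
  have := splitSum_map (LinearMap.applyₗ (R := K) (M₂ := W) (p k x)).toAddMonoidHom w ℓ
  refine Eq.trans ?_ this
  beta_reduce
  congr 1
  funext s t
  exact hl s t x

end FactorsThrough

/-- A function of words is multilinear if it is linear in every letter, and depends on a letter
of degree `k` only through its component of degree `k`. -/
def IsMultilin (p : ℤ → L →ₗ[K] L) (h : Word L → W) : Prop :=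
  ∀ u k v, FactorsThrough p k (fun x => h (u ++ (k, x) :: v))

variable {p : ℤ → L →ₗ[K] L} {p' : ℤ → L' →ₗ[K] L'}

theorem FactorsThrough.splitSum_append {Φ : Word L → Word L → W} {k : ℤ}
    (h1 : ∀ s s' t, FactorsThrough p k (fun x => Φ (s ++ (k, x) :: s') t))
    (h2 : ∀ s t t', FactorsThrough p k (fun x => Φ s (t ++ (k, x) :: t'))) (u v : Word L) :
    FactorsThrough p k (fun x => LInfty.splitSum (u ++ (k, x) :: v) Φ) := by
  induction u generalizing Φ with
  | nil =>
    simp only [List.nil_append, splitSum_cons]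
    exact .add (.splitSum fun s t => h1 [] s t) (.splitSum fun s t => (h2 s [] t).units_smul _)
  | cons a u ih =>
    simp only [List.cons_append, splitSum_cons]
    refine .add (ih (fun s s' t => h1 (a :: s) s' t) fun s t t' => h2 (a :: s) t t')
      (ih (fun s s' t => ?_) fun s t t' => (h2 s (a :: t) t').units_smul _)
    simp only [deg_append, deg_cons]
    exact (h1 s s' (a :: t)).units_smul _

namespace IsMultilin

theorem isAdditive {h : Word L → W} (hh : IsMultilin p h) : IsAdditive h := by
  intro u k x y v
  obtain ⟨ℓ, hl⟩ := hh u k v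
  simp only at hl
  simp [hl]

theorem map_units_smul {h : Word L → W} (hh : IsMultilin p h) (u : Word L) (k : ℤ) (c : ℤˣ) (x : L)
    (v : Word L) : h (u ++ (k, c • x) :: v) = c • h (u ++ (k, x) :: v) := by
  obtain ⟨ℓ, hl⟩ := hh u k v
  simp only at hl
  simp [hl, Units.smul_def]

theorem map_zero {h : Word L → W} (hh : IsMultilin p h) (u : Word L) (k : ℤ)
    (v : Word L) : h (u ++ (k, 0) :: v) = 0 := by
  obtain ⟨ℓ, hl⟩ := hh u k v
  simpa using hl 0

theorem cons {h : Word L → W} (hh : IsMultilin p h) (a : ℤ × L) :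
    IsMultilin p (fun u => h (a :: u)) :=
  fun u => hh (a :: u)

theorem add {h h' : Word L → W} (hh : IsMultilin p h) (hh' : IsMultilin p h') :
    IsMultilin p (fun u => h u + h' u) :=
  fun u k v => (hh u k v).add (hh' u k v)

theorem map {h : Word L → W} (hh : IsMultilin p h) (A : W →ₗ[K] W') :
    IsMultilin p (fun u => A (h u)) :=
  fun u k v => (hh u k v).map A

/-- This handles a variable letter buried inside the first argument of `h`. The operation `G` stands
for whatever is done with the remaining arguments, and only its linearity matters. -/
theorem factorsThrough_head {h : Word L' → W} (hh : IsMultilin p' h) {G : (Word L' → W) → W'}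
    (hadd : ∀ g g', G (fun u => g u + g' u) = G g + G g')
    (hsmul : ∀ (c : K) g, G (fun u => c • g u) = c • G g) (j : ℤ) {k : ℤ} {y : L → L'}
    (hy : FactorsThrough p k y) : FactorsThrough p k (fun x => G (fun u => h ((j, y x) :: u))) := by
  obtain ⟨ℓ, hl⟩ := hy
  have h2 : ∀ (u : Word L') (c : K) z, h ((j, c • z) :: u) = c • h ((j, z) :: u) := fun u c z => by
    obtain ⟨m, hm⟩ := hh [] j u
    simp only [List.nil_append] at hm
    simp [hm]
  refine ⟨(⟨⟨fun z => G (fun u => h ((j, z) :: u)), fun z z' => ?_⟩, fun c z => ?_⟩ :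
    L' →ₗ[K] W') ∘ₗ ℓ, fun x => by beta_reduce; rw [hl]; rfl⟩
  · rw [← hadd]
    congr 1
    funext u
    exact hh.isAdditive [] j z z' u
  · rw [RingHom.id_apply, ← hsmul]
    simp only [h2]

theorem compAux {h : Word L' → W} (hh : IsMultilin p' h) {f : Word L → L'}
    (hf : IsMultilin p f) (n : ℕ) : IsMultilin p (LInfty.compAux f n h) := by
  induction n generalizing h with
  | zero =>
    intro u k v
    cases u <;> exact .zero
  | succ n ih =>
    have key : ∀ u u' k t, FactorsThrough p k (fun x => LInfty.compAux f n
        (fun w => h ((deg (u ++ (k, x) :: u'), f (u ++ (k, x) :: u')) :: w)) t) := by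
      intro u u' k t
      simp only [deg_append, deg_cons]
      exact hh.factorsThrough_head (G := fun g => LInfty.compAux f n g t)
        (fun g g' => compAux_add f n g g' t) (fun c g => compAux_smul f n c g t) _ (hf u k u')
    intro u k v
    cases u with
    | nil => exact .splitSum fun s t => key [] s k t
    | cons a u =>
      exact .splitSum_append (fun s s' t => key (a :: s) s' k t)
        (fun s t t' => ih (hh.cons _) t k t') u v

theorem comp {h : Word L' → W} (hh : IsMultilin p' h) {f : Word L → L'}
    (hf : IsMultilin p f) : IsMultilin p (LInfty.comp h f) := by
  intro u k v
  have := hh.compAux hf (u.length + (v.length + 1)) u k v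
  simpa [LInfty.comp] using this

theorem insert {h : Word L → W} (hh : IsMultilin p h) {q : Word L → L}
    (hq : IsMultilin p q) : IsMultilin p (LInfty.insert h q) := by
  intro u k v
  refine .splitSum_append (fun s s' t => ?_) (fun s t t' => hh ((deg s + 1, q s) :: t) k t') u v
  simp only [deg_append, deg_cons]
  exact hh.factorsThrough_head (G := fun g => g t) (fun _ _ => rfl) (fun _ _ => rfl) _ (hq s k s')

end IsMultilin

/-- If the two letters land in the same subword, the swap rule for `Φ` applies. If they are
separated, the two mixed terms are interchanged, and the sign comes from one letter passing the
other. -/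
theorem splitSum_swap {L : Type*} {Φ : Word L → Word L → W} {a b : ℤ × L}
    (h1 : ∀ s s' t, Φ (s ++ a :: b :: s') t = Int.negOnePow (a.1 * b.1) • Φ (s ++ b :: a :: s') t)
    (h2 : ∀ s t t', Φ s (t ++ a :: b :: t') = Int.negOnePow (a.1 * b.1) • Φ s (t ++ b :: a :: t'))
    (u v : Word L) :
    splitSum (u ++ a :: b :: v) Φ = Int.negOnePow (a.1 * b.1) • splitSum (u ++ b :: a :: v) Φ := by
  induction u generalizing Φ with
  | nil =>
    have h1' := h1 []
    have h2' := fun s => h2 s []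
    simp only [List.nil_append, splitSum_cons, smul_add, deg_cons] at *
    simp only [h1', h2', ← splitSum_smul, smul_smul, ← Int.negOnePow_add, add_assoc]
    congr 1
    rw [add_left_comm]
    congr 1
    · refine splitSum_congr fun s t _ => ?_
      congr 2; ring
    congr 1
    · refine splitSum_congr fun s t _ => ?_
      congr 1
      exact (negOnePow_congr (a.1 * b.1) (by ring)).symm
    · refine splitSum_congr fun s t _ => ?_
      congr 2; ring
  | cons c u ih =>
    simp only [List.cons_append, splitSum_cons, smul_add]
    rw [ih (fun s s' t => h1 (c :: s) s' t) fun s t t' => h2 (c :: s) t t', ih]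
    · intro s s' t
      simp only [deg_append, deg_cons]
      rw [h1, smul_smul, smul_smul, mul_comm, add_left_comm a.1 b.1]
    · intro s t t'
      have := h2 s (c :: t) t'
      simp only [List.cons_append] at this
      rw [this, smul_smul, smul_smul, mul_comm]

end Multilinear
-- Graded symmetry, the identity morphism and degrees
section Symmetric

variable {K : Type*} [Field K] {L L' W W' : Type*} [AddCommGroup W] [Module K W]
  [AddCommGroup L] [Module K L] [AddCommGroup L'] [Module K L'] [AddCommGroup W']
  [Module K W'] {p : ℤ → L →ₗ[K] L} {p' : ℤ → L' →ₗ[K] L'}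

/-- Graded symmetric multilinear functions of words. -/
structure IsSymmMultilin (p : ℤ → L →ₗ[K] L) (h : Word L → W) : Prop where
  multilin : IsMultilin p h
  swap : IsSwapSymm h

namespace IsSymmMultilin

theorem cons {h : Word L → W} (hh : IsSymmMultilin p h) (a : ℤ × L) :
    IsSymmMultilin p (fun u => h (a :: u)) :=
  ⟨hh.1.cons a, hh.2.cons a⟩

theorem add {h h' : Word L → W} (hh : IsSymmMultilin p h) (hh' : IsSymmMultilin p h') :
    IsSymmMultilin p (fun u => h u + h' u) :=
  ⟨hh.1.add hh'.1, fun u a b v => by rw [hh.2, hh'.2, smul_add]⟩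

theorem map {h : Word L → W} (hh : IsSymmMultilin p h) (A : W →ₗ[K] W') :
    IsSymmMultilin p (fun u => A (h u)) :=
  ⟨hh.1.map A, fun u a b v => by rw [hh.2, Units.smul_def, map_zsmul, ← Units.smul_def]⟩

theorem compAux {h : Word L' → W} (hh : IsSymmMultilin p' h) {f : Word L → L'}
    (hf : IsSymmMultilin p f) (n : ℕ) : IsSymmMultilin p (LInfty.compAux f n h) := by
  refine ⟨hh.1.compAux hf.1 n, ?_⟩
  have hsm : ∀ (n : ℕ) (c : ℤˣ) (g : Word L' → W) (t : Word L),
      LInfty.compAux f n (fun u => c • g u) t = c • LInfty.compAux f n g t := fun n c g t => by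
    have := compAux_smul f n ((c : ℤ) : K) g t
    simp only [Int.cast_smul_eq_zsmul] at this
    exact this
  induction n generalizing h with
  | zero =>
    intro u a b v
    cases u <;> exact (smul_zero _).symm
  | succ n ih =>
    have key : ∀ u a b u' t, LInfty.compAux f n
        (fun w => h ((deg (u ++ a :: b :: u'), f (u ++ a :: b :: u')) :: w)) t =
        Int.negOnePow (a.1 * b.1) • LInfty.compAux f n
        (fun w => h ((deg (u ++ b :: a :: u'), f (u ++ b :: a :: u')) :: w)) t := by
      intro u a b u' t
      rw [← hsm]
      congr 1
      funext w
      rw [hf.swap]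
      refine (hh.1.map_units_smul [] _ _ _ w).trans ?_
      simp only [deg_append, deg_cons, List.nil_append, add_left_comm a.1]
    intro u a b v
    cases u with
    | cons c u =>
      exact splitSum_swap (fun s s' t => key (c :: s) a b s' t)
        (fun s t t' => ih (hh.cons _) t a b t') u v
    | nil =>
      simp only [List.nil_append, LInfty.compAux, splitSum_cons, smul_add]
      congr 1
      · rw [← splitSum_smul]
        exact splitSum_congr fun s t _ => key [] a b s t
      -- The second letter is outside the head block and so opens the next block. Exchanging the two
      -- letters exchanges these two blocks, which symmetry of `h` compensates.
      · cases n with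
        | zero => simp [LInfty.compAux, splitSum_zero]
        | succ n =>
          simp only [LInfty.compAux, ← splitSum_smul]
          rw [splitSum_left_comm]
          refine splitSum_congr fun s r _ => splitSum_congr fun s' t _ => ?_
          have h1 : (fun w => h ((deg (a :: s'), f (a :: s')) :: (deg (b :: s), f (b :: s)) :: w)) =
              fun w => Int.negOnePow (deg (a :: s') * deg (b :: s)) •
                h ((deg (b :: s), f (b :: s)) :: (deg (a :: s'), f (a :: s')) :: w) :=
            funext fun w => hh.2 [] _ _ w
          rw [h1, hsm]
          simp only [smul_smul, ← Int.negOnePow_add, deg_cons]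
          congr 1
          refine negOnePow_congr (deg s' * deg s + b.1 * deg s') ?_
          ring

theorem comp {h : Word L' → W} (hh : IsSymmMultilin p' h) {f : Word L → L'}
    (hf : IsSymmMultilin p f) : IsSymmMultilin p (LInfty.comp h f) := by
  refine ⟨hh.1.comp hf.1, fun u a b v => ?_⟩
  have := (hh.compAux hf (u.length + (v.length + 1 + 1))).swap u a b v
  simpa [LInfty.comp] using this

theorem insert {h : Word L → W} (hh : IsSymmMultilin p h) {q : Word L → L}
    (hq : IsSymmMultilin p q) : IsSymmMultilin p (LInfty.insert h q) := by
  refine ⟨hh.1.insert hq.1, fun u a b v => ?_⟩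
  refine splitSum_swap (fun s s' t => ?_) (fun s t t' => hh.2 ((deg s + 1, q s) :: t) a b t') u v
  rw [hq.swap]
  refine (hh.1.map_units_smul [] _ _ _ t).trans ?_
  simp only [deg_append, deg_cons, List.nil_append, add_left_comm a.1]

end IsSymmMultilin

/-- The word function of the identity morphism. -/
def idWord (p : ℤ → L →ₗ[K] L) : Word L → L
  | [a] => p a.1 a.2
  | _ => 0

theorem IsSymmMultilin.idWord :
    IsSymmMultilin p (LInfty.idWord p) := by
  constructor
  · rintro (_ | ⟨b, u⟩) k (_ | ⟨c, v⟩)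
    · exact ⟨LinearMap.id, fun x => rfl⟩
    · exact .zero
    · cases u <;> exact .zero
    · cases u <;> exact .zero
  · intro u a b v
    rcases u with _ | ⟨c, _ | ⟨d, u⟩⟩ <;> exact (smul_zero _).symm

/-- Only the partition into singletons has as many blocks as letters; any other one feeds `h` a
shorter word. -/
theorem comp_eq_self_of_length {h : Word L → W} (hh : IsMultilin p h)
    (hp : ∀ k x, p k (p k x) = p k x) {f : Word L → L} (hf : ∀ a, f [a] = p a.1 a.2) {w : Word L}
    (h0 : ∀ u, u.length < w.length → h u = 0) : comp h f w = h w := by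
  induction w using word_induction generalizing h with
  | nil => rfl
  | cons a w ih =>
    rw [comp_cons, splitSum_left_nil]
    · rw [ih w le_rfl (hh.cons _) fun u hu => h0 _ (by simpa using hu), hf]
      obtain ⟨ℓ, hl⟩ := hh [] a.1 w
      simp only [List.nil_append] at hl
      simp only [deg_cons, deg_nil, add_zero]
      rw [hl, hp, ← hl]
    · intro s t hs hst
      have h1 := hst.length_eq
      have h2 := List.length_pos_iff.2 hs
      simp only [List.length_append] at h1
      exact comp_eq_zero fun u hu => h0 _ (by simp; omega)

theorem comp_idWord {h : Word L → W} (hh : IsMultilin p h) (hp : ∀ k x, p k (p k x) = p k x) :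
    comp h (idWord p) = h := by
  funext w
  induction w using word_induction generalizing h with
  | nil => rfl
  | cons a w ih =>
    rw [comp_cons, splitSum_left_nil]
    · rw [ih w le_rfl (hh.cons _)]
      obtain ⟨ℓ, hl⟩ := hh [] a.1 w
      simp only [List.nil_append] at hl
      simp only [deg_cons, deg_nil, add_zero, idWord]
      rw [hl, hp, ← hl]
    · intro s t hs _
      obtain ⟨b, s, rfl⟩ := List.exists_cons_of_ne_nil hs
      exact comp_eq_zero fun u _ => hh.map_zero [] _ u

theorem idWord_comp {f : Word L → L} (hf : ∀ w, p (deg w) (f w) = f w) (h0 : f [] = 0) :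
    comp (idWord p) f = f := by
  funext w
  cases w with
  | nil => exact h0.symm
  | cons a w =>
    rw [comp_cons, splitSum_right_nil]
    · exact hf (a :: w)
    · intro s t ht _
      obtain ⟨b, t, rfl⟩ := List.exists_cons_of_ne_nil ht
      rw [comp_cons]
      exact splitSum_eq_zero fun s' t' _ => by exact comp_zero f t'

theorem insert_idWord {q : Word L → L} (hq : ∀ w, p (deg w + 1) (q w) = q w) :
    insert (idWord p) q = q := by
  funext w
  unfold insert
  rw [splitSum_right_nil]
  · exact hq w
  · intro s t ht _
    obtain ⟨b, t, rfl⟩ := List.exists_cons_of_ne_nil ht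
    rfl

theorem splitSum_mem {X : Type*} {S : AddSubgroup W} {w : Word X} {Φ : Word X → Word X → W}
    (h : ∀ s t, (s ++ t).Perm w → Φ s t ∈ S) : splitSum w Φ ∈ S := by
  induction w generalizing Φ with
  | nil => exact h [] [] (List.Perm.refl _)
  | cons a w ih =>
    refine S.add_mem (ih fun s t hst => h _ _ (by simpa using hst)) (ih fun s t hst => ?_)
    rw [Units.smul_def]
    exact S.zsmul_mem (h _ _ (List.perm_middle.trans (by simpa using hst))) _

/-- Compositions respect degrees. -/
theorem comp_mem {X X' : Type*} {P : ℤ → AddSubgroup W} {h : Word X' → W} (f : Word X → X')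
    (hh : ∀ u, h u ∈ P (deg u)) (w : Word X) : comp h f w ∈ P (deg w) := by
  induction w using word_induction generalizing h P with
  | nil => exact hh []
  | cons a w ih =>
    rw [comp_cons]
    refine splitSum_mem fun s t hst => ?_
    rw [deg_cons, deg_of_append_perm hst, ← add_assoc, ← deg_cons]
    exact ih t (length_right_le hst) (P := fun k => P (deg (a :: s) + k))
      fun u => by simpa using hh ((deg (a :: s), f (a :: s)) :: u)

theorem insert_mem {X : Type*} {P : ℤ → AddSubgroup W} {h : Word X → W} (q : Word X → X)
    (hh : ∀ u, h u ∈ P (deg u)) (w : Word X) : insert h q w ∈ P (deg w + 1) := by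
  refine splitSum_mem fun s t hst => ?_
  rw [deg_of_append_perm hst, add_right_comm]
  simpa using hh ((deg s + 1, q s) :: t)

end Symmetric
-- Inversion of unipotent morphisms and transport of the codifferential
section Transport

variable {K : Type*} [Field K] {L W : Type*} [AddCommGroup W] [Module K W]
  [AddCommGroup L] [Module K L] {p : ℤ → L →ₗ[K] L}

/-- Word functions with values in `L` which raise the degree by `r`. -/
def HasWordDegree (p : ℤ → L →ₗ[K] L) (r : ℤ) (f : Word L → L) : Prop :=
  ∀ w, p (deg w + r) (f w) = f w

/-- Taylor coefficients of a morphism whose linear part is the identity. -/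
structure IsUnipotent (p : ℤ → L →ₗ[K] L) (f : Word L → L) : Prop where
  symmMultilin : IsSymmMultilin p f
  degree : HasWordDegree p 0 f
  map_nil : f [] = 0
  map_singleton : ∀ a, f [a] = p a.1 a.2

theorem HasWordDegree.comp {r : ℤ} {h : Word L → L} (hh : HasWordDegree p r h) (f : Word L → L) :
    HasWordDegree p r (comp h f) := fun w =>
  comp_mem (P := fun k => (LinearMap.eqLocus (p (k + r)) LinearMap.id).toAddSubgroup) f
    (fun u => hh u) w

theorem HasWordDegree.insert {r : ℤ} {h : Word L → L} (hh : HasWordDegree p r h)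
    (q : Word L → L) : HasWordDegree p (r + 1) (insert h q) := fun w => by
  have := insert_mem (P := fun k => (LinearMap.eqLocus (p (k + r)) LinearMap.id).toAddSubgroup) q
    (fun u => hh u) w
  rw [add_comm r, ← add_assoc]
  exact this

theorem IsUnipotent.idWord (hp : ∀ k x, p k (p k x) = p k x) : IsUnipotent p (idWord p) := by
  refine ⟨.idWord, ?_, rfl, fun _ => rfl⟩
  rintro (_ | ⟨a, _ | ⟨b, w⟩⟩) <;> simp [LInfty.idWord, hp]

/-- The fixed points of this operation are the solutions of `comp g f = idWord p`. -/
def inverseStep (p : ℤ → L →ₗ[K] L) (f g : Word L → L) (w : Word L) : L :=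
  idWord p w + (g w + (-1 : K) • comp g f w)

theorem IsUnipotent.inverseStep (hp : ∀ k x, p k (p k x) = p k x) {f g : Word L → L}
    (hf : IsUnipotent p f) (hg : IsUnipotent p g) : IsUnipotent p (inverseStep p f g) := by
  refine ⟨.add .idWord (.add hg.1 ((hg.1.comp hf.1).map (LinearMap.lsmul K L (-1)))),
    fun w => ?_, ?_, fun a => ?_⟩
  · have h1 := (IsUnipotent.idWord hp).degree w
    have h2 := hg.degree w
    have h3 := hg.degree.comp f w
    rw [add_zero] at *
    simp [LInfty.inverseStep, h1, h2, h3]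
  · simp [LInfty.inverseStep, LInfty.idWord, hg.map_nil]
  · have h1 : LInfty.comp g f [a] = g [a] :=
      comp_eq_self_of_length hg.1.1 hp hf.map_singleton fun u hu => by
        obtain rfl : u = [] := by simpa using hu
        exact hg.map_nil
    simp [LInfty.inverseStep, LInfty.idWord, h1]

/-- In `g - g ∘ f` the term of top arity cancels, because the linear part of `f` is the identity.
Each step is thus determined by the values on strictly shorter words. -/
theorem inverseStep_congr (hp : ∀ k x, p k (p k x) = p k x) {f g g' : Word L → L}
    (hf : IsUnipotent p f) (hg : IsUnipotent p g) (hg' : IsUnipotent p g') {w : Word L}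
    (h : ∀ u, u.length < w.length → g u = g' u) : inverseStep p f g w = inverseStep p f g' w := by
  have h1 := comp_eq_self_of_length (hg.1.1.add (hg'.1.1.map (LinearMap.lsmul K L (-1)))) hp
    hf.map_singleton (w := w) fun u hu => by simp [h u hu]
  have h2 := comp_map_const (LinearMap.lsmul K L (-1)).toAddMonoidHom g' f w
  rw [LinearMap.toAddMonoidHom_coe] at h2
  rw [comp_add, h2] at h1
  simp only [LinearMap.lsmul_apply, neg_smul, one_smul] at h1
  unfold inverseStep
  simp only [neg_smul, one_smul]
  rw [add_right_inj, ← sub_eq_add_neg, ← sub_eq_add_neg, sub_eq_sub_iff_sub_eq_sub,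
    sub_eq_add_neg, sub_eq_add_neg, h1]

/-- Unipotent morphisms have left inverses. -/
theorem IsUnipotent.exists_left_inverse (hp : ∀ k x, p k (p k x) = p k x) {f : Word L → L}
    (hf : IsUnipotent p f) : ∃ g, IsUnipotent p g ∧ LInfty.comp g f = LInfty.idWord p := by
  -- Fixed-point iteration from the identity. All iterates agree on words of length at most one, and
  -- each further step stabilises one more length.
  set G : ℕ → Word L → L := fun n => (LInfty.inverseStep p f)^[n] (LInfty.idWord p) with hG
  have hsucc : ∀ n, G (n + 1) = LInfty.inverseStep p f (G n) := fun n =>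
    Function.iterate_succ_apply' _ _ _
  have hU : ∀ n, IsUnipotent p (G n) := by
    intro n
    induction n with
    | zero => exact .idWord hp
    | succ n ih => rw [hsucc]; exact hf.inverseStep hp ih
  have hstab : ∀ n w, w.length ≤ n + 1 → G (n + 1) w = G n w := by
    intro n
    induction n with
    | zero =>
      rintro (_ | ⟨a, _ | ⟨b, w⟩⟩) hw
      · rw [(hU _).map_nil, (hU _).map_nil]
      · rw [(hU _).map_singleton, (hU _).map_singleton]
      · simp at hw
    | succ n ih =>
      intro w hw
      rw [hsucc (n + 1), hsucc n]
      exact inverseStep_congr hp hf (by rw [← hsucc]; exact hU _) (hU n)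
        fun u hu => by rw [← hsucc]; exact ih u (by omega)
  have hstab' : ∀ n (w : Word L), w.length ≤ n → G w.length w = G n w := by
    intro n w hn
    induction n, hn using Nat.le_induction with
    | base => rfl
    | succ n hn ih => rw [ih, hstab n w (by omega)]
  -- The diagonal limit. Multilinearity and symmetry concern words of one fixed length, hence a
  -- single iterate.
  refine ⟨fun w => G w.length w, ⟨⟨fun u k v => ?_, fun u a b v => ?_⟩, fun w => (hU _).degree w,
    (hU _).map_nil, fun a => (hU _).map_singleton a⟩, ?_⟩
  · have := (hU (u.length + (v.length + 1))).1.1 u k v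
    simpa using this
  · have := (hU (u.length + (v.length + 1 + 1))).1.2 u a b v
    simpa using this
  · funext w
    rw [comp_congr_length (h' := G w.length) fun u hu => hstab' _ u hu]
    have h1 := hstab w.length w (by omega)
    rw [hsucc] at h1
    unfold LInfty.inverseStep at h1
    rw [neg_one_smul, ← add_assoc, add_comm (LInfty.idWord p w), add_assoc, add_eq_left,
      ← sub_eq_add_neg, sub_eq_zero] at h1
    exact h1.symm

/-- A left inverse `g` of `f` is unipotent and has a left inverse `e` itself; then `e = e ∘ (g ∘ f)
= (e ∘ g) ∘ f = f`. -/
theorem IsUnipotent.exists_inverse (hp : ∀ k x, p k (p k x) = p k x) {f : Word L → L}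
    (hf : IsUnipotent p f) : ∃ g, IsUnipotent p g ∧ LInfty.comp g f = LInfty.idWord p ∧
      LInfty.comp f g = LInfty.idWord p := by
  obtain ⟨g, hg, hgf⟩ := hf.exists_left_inverse hp
  obtain ⟨e, he, heg⟩ := hg.exists_left_inverse hp
  refine ⟨g, hg, hgf, ?_⟩
  have h1 : e = f := by
    rw [← comp_idWord he.1.1 hp, ← hgf]
    funext w
    rw [← comp_assoc he.1.1.isAdditive, heg, idWord_comp _ hf.map_nil]
    simpa [HasWordDegree] using hf.degree
  rw [← h1, heg]

/-- The transport of a homological vector field along an invertible morphism. -/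
def transport (f g q : Word L → L) : Word L → L := comp (insert f q) g

theorem comp_transport (hp : ∀ k x, p k (p k x) = p k x) {f g q : Word L → L}
    (hf : IsUnipotent p f) (hgf : comp g f = idWord p) (hq : IsSymmMultilin p q) :
    comp (transport f g q) f = insert f q := by
  have h := hf.1.1.insert hq.1
  funext w
  rw [transport, comp_assoc h.isAdditive, hgf, comp_idWord h hp]

/-- The relation may be tested after composition with the invertible `f`, where the morphism
relation of `f` reduces both sides to `q`. -/
theorem insert_transport (hp : ∀ k x, p k (p k x) = p k x) {f g q : Word L → L}
    (hf : IsUnipotent p f) (hg : IsUnipotent p g) (hgf : comp g f = idWord p)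
    (hfg : comp f g = idWord p) (hq : IsSymmMultilin p q) (hqd : HasWordDegree p 1 q) :
    insert g (transport f g q) = comp q g := by
  have h : IsMultilin p (insert g (transport f g q)) :=
    hg.1.1.insert ((hf.1.1.insert hq.1).comp hg.1.1)
  have h1 : comp (insert g (transport f g q)) f = q := by
    funext w
    rw [← insert_comp hg.1.1.isAdditive (comp_transport hp hf hgf hq).symm, hgf, insert_idWord hqd]
  conv_rhs => rw [← h1]
  funext w
  rw [comp_assoc h.isAdditive, hfg]
  exact congrFun (comp_idWord h hp).symm w

/-- Since `g` is a morphism, applying the new coderivation to `comp (insert f q) g` equals applying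
the old one twice to `f` and then composing with `g`. -/
theorem insert_transport_transport [CharZero K] (hp : ∀ k x, p k (p k x) = p k x)
    {f g q : Word L → L} (hf : IsUnipotent p f) (hg : IsUnipotent p g)
    (hgf : comp g f = idWord p) (hfg : comp f g = idWord p) (hq : IsSymmMultilin p q)
    (hqd : HasWordDegree p 1 q) (hqq : insert q q = fun _ => 0) :
    insert (transport f g q) (transport f g q) = fun _ => 0 := by
  funext w
  have h1 := insert_comp (hf.1.1.insert hq.1).isAdditive
    (insert_transport hp hf hg hgf hfg hq hqd) w
  rw [insert_insert K hf.1.1.isAdditive hf.1.2 hqq, comp_zero] at h1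
  exact h1

end Transport

/-! ### Koszul signs of permutations -/

/-- An adjacent transposition changes the relative order of a single pair. Reindexing the product by
positions makes all other factors agree, and signs are their own inverses. -/
theorem koszulSign_mul_swap {n : ℕ} (σ : Equiv.Perm (Fin n)) (d : Fin n → ℤ) {i j : Fin n}
    (hij : (j : ℕ) = i + 1) :
    koszulSign (fun x => (σ * Equiv.swap i j).symm x) d =
      Int.negOnePow (d (σ i) * d (σ j)) * koszulSign (fun x => σ.symm x) d := by
  have h1 : ∀ τ : Equiv.Perm (Fin n), koszulSign (fun x => τ.symm x) d = ∏ z : Fin n × Fin n,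
      if σ z.1 < σ z.2 ∧ τ.symm (σ z.2) < τ.symm (σ z.1) then
        Int.negOnePow (d (σ z.1) * d (σ z.2)) else 1 := by
    intro τ
    rw [Fintype.prod_prod_type, koszulSign, ← Equiv.prod_comp σ]
    exact Finset.prod_congr rfl fun x _ => (Equiv.prod_comp σ _).symm
  have hne : i ≠ j := fun h => by rw [h] at hij; omega
  rw [← mul_inv_eq_iff_eq_mul, Int.units_inv_eq_self, h1, h1, ← Finset.prod_mul_distrib,
    Fintype.prod_eq_mul (i, j) (j, i) (by simp [hne])]
  · have h2 : (i : ℕ) < j := by omega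
    have h3 : i < j := h2
    have h4 : σ i ≠ σ j := σ.injective.ne hne
    rcases lt_or_gt_of_ne h4 with h | h
    · simp [Equiv.Perm.mul_def, h, h3, h.not_gt, h3.not_gt]
    · simp [Equiv.Perm.mul_def, h, h3, h.not_gt, h3.not_gt, mul_comm]
  · rintro ⟨x, y⟩ ⟨hx, hy⟩
    have h2 : Equiv.swap i j y < Equiv.swap i j x ↔ y < x := by
      simp only [ne_eq, Prod.mk.injEq, not_and, Equiv.swap_apply_def, Fin.ext_iff, Fin.lt_def] at *
      split_ifs <;> omega
    have h3 : ((σ * Equiv.swap i j).symm (σ y) < (σ * Equiv.swap i j).symm (σ x)) ↔ y < x := by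
      simpa [Equiv.Perm.mul_def] using h2
    simp only [h3, Equiv.symm_apply_apply, Int.units_mul_self]

theorem koszulSign_one {n : ℕ} (d : Fin n → ℤ) :
    koszulSign (fun x => (1 : Equiv.Perm (Fin n)).symm x) d = 1 := by
  refine Finset.prod_eq_one fun x _ => Finset.prod_eq_one fun y _ => if_neg ?_
  rintro ⟨h1, h2⟩
  exact lt_asymm h1 h2

theorem ofFn_update {X : Type*} {n : ℕ} (a : Fin n → X) (i : Fin n) (x : X) :
    List.ofFn (Function.update a i x) =
      (List.ofFn a).take i ++ x :: (List.ofFn a).drop (i + 1) := by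
  have h := List.set_eq_take_append_cons_drop (l := List.ofFn a) (i := i) (a := x)
  rw [if_pos (by simp)] at h
  rw [← h]
  refine List.ext_getElem (by simp) fun k hk _ => ?_
  simp [List.getElem_set, Function.update_apply, Fin.ext_iff, eq_comm]

theorem ofFn_eq_append {X : Type*} {n : ℕ} (a : Fin n → X) {i j : Fin n} (hij : (j : ℕ) = i + 1) :
    List.ofFn a = (List.ofFn a).take i ++ a i :: a j :: (List.ofFn a).drop (i + 2) := by
  have h1 : (i : ℕ) < (List.ofFn a).length := by simp
  have h2 : (i : ℕ) + 1 < (List.ofFn a).length := by rw [← hij]; simp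
  conv_lhs => rw [← List.take_append_drop i (List.ofFn a), List.drop_eq_getElem_cons h1,
    List.drop_eq_getElem_cons h2]
  have h3 := j.isLt
  simp [← hij]
  omega

theorem ofFn_swap {X : Type*} {n : ℕ} (a : Fin n → X) {i j : Fin n} (hij : (j : ℕ) = i + 1) :
    List.ofFn (fun k => a (Equiv.swap i j k)) =
      (List.ofFn a).take i ++ a j :: a i :: (List.ofFn a).drop (i + 2) := by
  rw [ofFn_eq_append (fun k => a (Equiv.swap i j k)) hij, Equiv.swap_apply_left,
    Equiv.swap_apply_right]
  congr 1
  · refine List.ext_getElem (by simp) fun k hk _ => ?_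
    simp only [List.length_take, List.length_ofFn] at hk
    simp only [List.getElem_take, List.getElem_ofFn]
    rw [Equiv.swap_apply_of_ne_of_ne] <;> simp [Fin.ext_iff] <;> omega
  · congr 2
    refine List.ext_getElem (by simp) fun k hk _ => ?_
    simp only [List.length_drop, List.length_ofFn] at hk
    simp only [List.getElem_drop, List.getElem_ofFn]
    rw [Equiv.swap_apply_of_ne_of_ne] <;> simp [Fin.ext_iff] <;> omega

/-! ### Families of multilinear maps and functions of words -/

section Families

variable {K : Type*} [Field K] {L W : Type*} [AddCommGroup W] [Module K W]
  [AddCommGroup L] [Module K L] 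

/-- The value of a family on the components of the letters of a word in the degrees of the
letters. -/
def evalWord (p : ℤ → L →ₗ[K] L) : Family K L W → Word L → W
  | h, [] => h 0 ![]
  | h, a :: w => evalWord p (fun n => (h (n + 1)).curryLeft (p a.1 a.2)) w

variable {p : ℤ → L →ₗ[K] L}

theorem evalWord_ofFn (h : Family K L W) {n : ℕ} (x : Fin n → ℤ × L) :
    evalWord p h (List.ofFn x) = h n (fun i => p (x i).1 (x i).2) := by
  induction n generalizing h with
  | zero => simp only [List.ofFn_zero, evalWord]; congr 1; exact Subsingleton.elim _ _
  | succ n ih =>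
    rw [List.ofFn_succ, evalWord, ih, MultilinearMap.curryLeft_apply]
    congr 1
    funext i
    refine Fin.cases ?_ (fun i => ?_) i <;> simp

theorem evalWord_add (h h' : Family K L W) (w : Word L) :
    evalWord p (h + h') w = evalWord p h w + evalWord p h' w := by
  induction w generalizing h h' with
  | nil => rfl
  | cons a w ih => exact ih (fun n => (h (n + 1)).curryLeft _) fun n => (h' (n + 1)).curryLeft _

theorem evalWord_smul (c : K) (h : Family K L W) (w : Word L) :
    evalWord p (c • h) w = c • evalWord p h w := by
  induction w generalizing h with
  | nil => rfl
  | cons a w ih => exact ih fun n => (h (n + 1)).curryLeft _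

theorem isMultilin_evalWord (h : Family K L W) : IsMultilin p (evalWord p h) := by
  intro u k v
  induction u generalizing h with
  | cons a u ih => exact ih _
  | nil =>
    refine ⟨⟨⟨fun y => evalWord p (fun n => (h (n + 1)).curryLeft y) v, fun y y' => ?_⟩,
      fun c y => ?_⟩, fun x => rfl⟩
    · rw [← evalWord_add]; congr 1; funext n; simp
    · rw [RingHom.id_apply, ← evalWord_smul]
      change evalWord p (fun n => (h (n + 1)).curryLeft (c • y)) v = _
      congr 1; funext n; simp

theorem isSymmMultilin_evalWord {𝓐 : ℤ → Submodule K L} (hp : ∀ k x, p k x ∈ 𝓐 k)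
    {h : Family K L W} (hh : IsGradedSymm 𝓐 h) : IsSymmMultilin p (evalWord p h) := by
  refine ⟨isMultilin_evalWord h, fun u a b v => ?_⟩
  set x : Fin (u ++ b :: a :: v).length → ℤ × L := (u ++ b :: a :: v).get with hx
  have h1 : u.length < (u ++ b :: a :: v).length := by simp
  have h2 : u.length + 1 < (u ++ b :: a :: v).length := by simp
  have h3 : u ++ b :: a :: v = List.ofFn x := (List.ofFn_get _).symm
  have h4 : u ++ a :: b :: v =
      List.ofFn (fun i => x (Equiv.swap ⟨u.length, h1⟩ ⟨u.length + 1, h2⟩ i)) := by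
    have h := (ofFn_eq_append x (i := ⟨u.length, h1⟩) (j := ⟨u.length + 1, h2⟩) rfl).symm
    rw [ofFn_swap x rfl]
    rw [← h3] at h ⊢
    simp [hx]
  have h5 := hh _ (Equiv.swap ⟨u.length, h1⟩ ⟨u.length + 1, h2⟩) (fun i => (x i).1)
    (fun i => p (x i).1 (x i).2) fun i => hp _ _
  rw [h4, evalWord_ofFn, h5]
  conv_rhs => rw [h3, evalWord_ofFn]
  have h6 := koszulSign_mul_swap 1 (fun i => (x i).1)
    (i := ⟨u.length, h1⟩) (j := ⟨u.length + 1, h2⟩) rfl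
  rw [one_mul, koszulSign_one, mul_one] at h6
  rw [h6]
  congr 2
  simp [hx, mul_comm]

theorem IsMultilin.map_proj (hp : ∀ k x, p k (p k x) = p k x) {H : Word L → W}
    (hH : IsMultilin p H) (w : Word L) : H (w.map fun a => (a.1, p a.1 a.2)) = H w := by
  induction w generalizing H with
  | nil => rfl
  | cons a w ih =>
    obtain ⟨ℓ, hl⟩ := hH [] a.1 w
    simp only [List.nil_append] at hl
    rw [List.map_cons, ih (hH.cons _), hl, hp, ← hl]

theorem IsMultilin.exists_linear {H : Word L → W} (hH : IsMultilin p H) {n : ℕ} (d : Fin n → ℤ)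
    (a : Fin n → L) (i : Fin n) : ∃ ℓ : L →ₗ[K] W, ∀ x,
      H (List.ofFn fun j => (d j, Function.update a i x j)) = ℓ (p (d i) x) := by
  obtain ⟨ℓ, hl⟩ := hH ((List.ofFn fun j => (d j, a j)).take i) (d i)
    ((List.ofFn fun j => (d j, a j)).drop (i + 1))
  refine ⟨ℓ, fun x => ?_⟩
  rw [← hl]
  beta_reduce
  rw [← ofFn_update]
  congr 2
  funext j
  by_cases h : j = i
  · subst h; simp
  · simp [h]

/-- The restriction of a multilinear function of words to words with given degrees. -/
def IsMultilin.toMultilinearMap {H : Word L → W} (hH : IsMultilin p H) {n : ℕ} (d : Fin n → ℤ) :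
    MultilinearMap K (fun _ : Fin n => L) W where
  toFun a := H (List.ofFn fun i => (d i, a i))
  map_update_add' {inst} a i x y := by
    obtain rfl := Subsingleton.elim inst (instDecidableEqFin n)
    obtain ⟨ℓ, hl⟩ := hH.exists_linear d a i
    simp only [hl, map_add]
  map_update_smul' {inst} a i c x := by
    obtain rfl := Subsingleton.elim inst (instDecidableEqFin n)
    obtain ⟨ℓ, hl⟩ := hH.exists_linear d a i
    simp only [hl, map_smul]

/-- The family of multilinear maps determined by a function of words. -/
def IsMultilin.toFamily {H : Word L → W} (hH : IsMultilin p H) (I : Finset ℤ) : Family K L W :=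
  fun n => ∑ d ∈ Fintype.piFinset (fun _ : Fin n => I), hH.toMultilinearMap d

/-- On letters projected to their degrees, only the summand with exactly these degrees survives. If
some degree is outside `I`, the corresponding projection is zero and both sides vanish. -/
theorem evalWord_toFamily {I : Finset ℤ} (hI : ∀ k, k ∉ I → p k = 0)
    (hp : ∀ k x, p k (p k x) = p k x) (hp' : ∀ j k x, j ≠ k → p j (p k x) = 0)
    {H : Word L → W} (hH : IsMultilin p H) : evalWord p (hH.toFamily I) = H := by
  funext w
  obtain ⟨n, x, rfl⟩ : ∃ (n : ℕ) (x : Fin n → ℤ × L), w = List.ofFn x :=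
    ⟨_, w.get, (List.ofFn_get w).symm⟩
  rw [evalWord_ofFn, IsMultilin.toFamily, sum_apply]
  have h0 : ∀ d : Fin n → ℤ, d ≠ (fun i => (x i).1) →
      hH.toMultilinearMap d (fun i => p (x i).1 (x i).2) = 0 := by
    intro d hd
    obtain ⟨i, hi⟩ := Function.ne_iff.1 hd
    obtain ⟨ℓ, hl⟩ := hH.exists_linear d (fun i => p (x i).1 (x i).2) i
    have := hl (p (x i).1 (x i).2)
    rw [hp' _ _ _ hi, map_zero] at this
    rw [← this]
    simp [IsMultilin.toMultilinearMap]
  have h1 : hH.toMultilinearMap (fun i => (x i).1) (fun i => p (x i).1 (x i).2) =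
      H (List.ofFn x) := by
    rw [← hH.map_proj hp, List.map_ofFn]
    rfl
  by_cases h : (fun i => (x i).1) ∈ Fintype.piFinset (fun _ : Fin n => I)
  · rw [Finset.sum_eq_single_of_mem _ h fun d _ hd => h0 d hd, h1]
  · rw [Finset.sum_eq_zero fun d hd => h0 d fun h' => h (h' ▸ hd), ← h1]
    obtain ⟨i, hi⟩ : ∃ i, (x i).1 ∉ I := by simpa using h
    rw [(hH.toMultilinearMap _).map_coord_zero i (by simp [hI _ hi])]

theorem isGradedSymm_of_evalWord {𝓐 : ℤ → Submodule K L} (hp : ∀ k, ∀ x ∈ 𝓐 k, p k x = x)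
    {h : Family K L W} (hh : IsSwapSymm (evalWord p h)) : IsGradedSymm 𝓐 h := by
  have h1 : ∀ {n : ℕ} (d : Fin n → ℤ) (a : Fin n → L), IsHomog 𝓐 d a →
      evalWord p h (List.ofFn fun i => (d i, a i)) = h n a := fun d a ha => by
    rw [evalWord_ofFn]
    congr 1
    funext i
    exact hp _ _ (ha i)
  intro n σ d a ha
  rcases n with _ | n
  · obtain rfl := Subsingleton.elim σ 1
    rw [koszulSign_one, one_smul]; rfl
  -- Adjacent transpositions generate the symmetric group, so the swap rule suffices.
  have hσ : σ ∈ Submonoid.closure (Set.range fun i : Fin n => Equiv.swap i.castSucc i.succ) := by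
    rw [Equiv.Perm.mclosure_swap_castSucc_succ]; trivial
  induction hσ using Submonoid.closure_induction_right with
  | one => rw [koszulSign_one, one_smul]; rfl
  | mul_right σ _ τ hτ ih =>
    obtain ⟨i, rfl⟩ := hτ
    have hij : (i.succ : ℕ) = i.castSucc + 1 := by simp
    rw [koszulSign_mul_swap σ d hij, mul_smul, ← ih, ← h1 _ _ fun k => ha (σ k),
      ← h1 (fun k => d ((σ * Equiv.swap i.castSucc i.succ) k)) _ fun k => ha _]
    have h2 := ofFn_swap (fun k => (d (σ k), a (σ k))) hij
    have h3 := ofFn_eq_append (fun k => (d (σ k), a (σ k))) hij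
    simp only [Equiv.Perm.mul_apply]
    rw [h2, hh, mul_comm (d (σ i.succ)), ← h3]

end Families

/-! ### Sums over colourings -/

section Blocks

variable {L L' W : Type*} [AddCommGroup W]

/-- The sum of `Ψ B` over all ways to distribute the letters of a word over `j` subwords
`B 0, ..., B (j - 1)`, with Koszul signs. -/
def blockSum (j : ℕ) : Word L → ((Fin j → Word L) → W) → W
  | [], Ψ => Ψ fun _ => []
  | a :: w, Ψ => ∑ i : Fin j, blockSum j w fun B =>
      Int.negOnePow (a.1 * ∑ k with k < i, deg (B k)) • Ψ (Function.update B i (a :: B i))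

theorem blockSum_smul (j : ℕ) (w : Word L) (c : ℤˣ) (Ψ : (Fin j → Word L) → W) :
    blockSum j w (fun B => c • Ψ B) = c • blockSum j w Ψ := by
  induction w generalizing Ψ with
  | nil => rfl
  | cons a w ih =>
    simp only [blockSum, Finset.smul_sum, ← ih, smul_smul, mul_comm]

/-- A letter sent to a later block passes the first block and then the earlier ones among the rest,
so its sign factors accordingly. -/
theorem blockSum_succ (j : ℕ) (w : Word L) (Ψ : (Fin (j + 1) → Word L) → W) :
    blockSum (j + 1) w Ψ = splitSum w fun s t => blockSum j t fun B => Ψ (Fin.cons s B) := by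
  induction w generalizing Ψ with
  | nil =>
    simp only [blockSum, splitSum_nil]
    congr 1
    funext i
    refine Fin.cases ?_ (fun i => ?_) i <;> rfl
  | cons a w ih =>
    simp only [blockSum, splitSum_cons, ih, Fin.sum_univ_succ, Finset.smul_sum, splitSum_sum]
    congr 1
    · simp
    · refine Finset.sum_congr rfl fun i _ => ?_
      refine splitSum_congr fun s t _ => ?_
      rw [← blockSum_smul]
      congr 1
      funext B
      rw [smul_smul, ← Int.negOnePow_add, ← mul_add]
      congr 3
      · rw [Finset.sum_filter, Fin.sum_univ_succ, Finset.sum_filter]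
        simp
      · rw [Fin.cons_update]
        simp

theorem blockSum_zero_cons (a : ℤ × L) (w : Word L) (Ψ : (Fin 0 → Word L) → W) :
    blockSum 0 (a :: w) Ψ = 0 := by
  simp [blockSum]

theorem blockSum_two (w : Word L) (Φ : Word L → Word L → W) :
    blockSum 2 w (fun B => Φ (B 0) (B 1)) = splitSum w Φ := by
  rw [blockSum_succ]
  refine splitSum_congr fun s t _ => ?_
  rw [blockSum_succ, splitSum_right_nil]
  · rfl
  · intro s' t' ht' _
    obtain ⟨b, t', rfl⟩ := List.exists_cons_of_ne_nil ht'
    exact blockSum_zero_cons _ _ _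

/-- The subword formed by the letters of colour `i`. -/
def block {X : Type*} {n j : ℕ} (c : Fin n → Fin j) (x : Fin n → X) (i : Fin j) : List X :=
  ((List.finRange n).filter (fun p => c p = i)).map x

theorem block_cons {X : Type*} {n j : ℕ} (i : Fin j) (c : Fin n → Fin j) (x : Fin (n + 1) → X) :
    block (Fin.cons i c : Fin (n + 1) → Fin j) x =
      Function.update (block c fun p => x p.succ) i (x 0 :: block c (fun p => x p.succ) i) := by
  funext k
  by_cases hk : k = i
  · subst hk
    simp [block, List.finRange_succ, List.filter_map, Function.comp_def]
  · simp [block, List.finRange_succ, List.filter_map, Function.comp_def, hk, Ne.symm hk]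

theorem negOnePow_sum {ι : Type*} (s : Finset ι) (f : ι → ℤ) :
    Int.negOnePow (∑ i ∈ s, f i) = ∏ i ∈ s, Int.negOnePow (f i) := by
  classical
  induction s using Finset.induction_on with
  | empty => rfl
  | insert i s hi ih => rw [Finset.sum_insert hi, Finset.prod_insert hi, Int.negOnePow_add, ih]

theorem koszulSign_cons {n : ℕ} {α : Type*} [LinearOrder α] (i : α) (c : Fin n → α)
    (d : Fin (n + 1) → ℤ) : koszulSign (Fin.cons i c : Fin (n + 1) → α) d =
      Int.negOnePow (d 0 * ∑ q with c q < i, d q.succ) * koszulSign c fun p => d p.succ := by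
  rw [koszulSign, Fin.prod_univ_succ]
  congr 1
  · rw [Fin.prod_univ_succ, Finset.mul_sum, negOnePow_sum, Finset.prod_filter]
    simp
  · refine Finset.prod_congr rfl fun p _ => ?_
    rw [Fin.prod_univ_succ]
    simp

theorem sum_deg_block {n j : ℕ} (c : Fin n → Fin j) (x : Fin n → ℤ × L) (i : Fin j) :
    ∑ k with k < i, deg (block c x k) = ∑ q with c q < i, (x q).1 := by
  have h : ∀ k, deg (block c x k) = ∑ q with c q = k, (x q).1 := fun k => by
    rw [Finset.sum_filter, ← List.sum_ofFn, List.ofFn_eq_map]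
    unfold deg block
    generalize List.finRange n = l
    induction l with
    | nil => rfl
    | cons a l ih => by_cases ha : c a = k <;> simpa [ha] using ih
  simp only [h]
  rw [← Finset.sum_fiberwise_of_maps_to (s := Finset.univ.filter fun q => c q < i)
    (t := Finset.univ.filter fun k => k < i) (g := c) (by simp)]
  refine Finset.sum_congr rfl fun k hk => Finset.sum_congr ?_ fun _ _ => rfl
  ext q
  simp only [Finset.mem_filter, Finset.mem_univ, true_and] at hk ⊢
  constructor
  · rintro rfl; exact ⟨hk, rfl⟩
  · exact fun h => h.2

/-- This links the closed formula for the Koszul sign with the recursion: the colour of the first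
letter is its block, and its inversions are with the letters of smaller colour. -/
theorem sum_koszulSign {n j : ℕ} (x : Fin n → ℤ × L) (Ψ : (Fin j → Word L) → W) :
    ∑ c : Fin n → Fin j, koszulSign c (fun p => (x p).1) • Ψ (block c x) =
      blockSum j (List.ofFn x) Ψ := by
  induction n generalizing Ψ with
  | zero =>
    rw [Fintype.sum_unique]
    simp [koszulSign, blockSum]
    rfl
  | succ n ih =>
    rw [List.ofFn_succ, blockSum, ← (Fin.consEquiv fun _ => Fin j).sum_comp, Fintype.sum_prod_type]
    refine Finset.sum_congr rfl fun i _ => ?_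
    rw [← ih]
    refine Finset.sum_congr rfl fun c _ => ?_
    change koszulSign (Fin.cons i c : Fin (n + 1) → Fin j) _ •
      Ψ (block (Fin.cons i c : Fin (n + 1) → Fin j) x) = _
    rw [koszulSign_cons, block_cons, sum_deg_block, smul_smul, mul_comm]

theorem ofFn_orderEmbOfFin {n : ℕ} (S : Finset (Fin n)) :
    List.ofFn (S.orderEmbOfFin rfl) = (List.finRange n).filter (· ∈ S) := by
  refine List.SortedLT.eq_of_mem_iff
    (List.sortedLT_ofFn_iff.2 (S.orderEmbOfFin rfl).strictMono)
    ((List.pairwise_lt_finRange n).filter _).sortedLT fun a => ?_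
  rw [List.mem_ofFn', Finset.range_orderEmbOfFin]
  simp

theorem ofFn_subword {X : Type*} {n : ℕ} (S : Finset (Fin n)) (x : Fin n → X) :
    List.ofFn (subword S x) = ((List.finRange n).filter (· ∈ S)).map x := by
  rw [← ofFn_orderEmbOfFin, List.map_ofFn]
  rfl

theorem ofFn_subword_colour {X : Type*} {n j : ℕ} (c : Fin n → Fin j) (x : Fin n → X) (i : Fin j) :
    List.ofFn (subword {p : Fin n | c p = i} x) = block c x i := by
  rw [ofFn_subword, block]
  simp

theorem sum_unshuffleSign {n : ℕ} (x : Fin n → ℤ × L) (Φ : Word L → Word L → W) :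
    ∑ S : Finset (Fin n), unshuffleSign S (fun p => (x p).1) •
      Φ (List.ofFn (subword S x)) (List.ofFn (subword Sᶜ x)) = splitSum (List.ofFn x) Φ := by
  rw [← blockSum_two, ← sum_koszulSign]
  let e : Finset (Fin n) ≃ (Fin n → Fin 2) :=
    { toFun := fun S p => if p ∈ S then 0 else 1
      invFun := fun c => Finset.univ.filter fun p => c p = 0
      left_inv := fun S => by ext p; simp
      right_inv := fun c => by
        funext p
        have := Fin.eq_zero_or_eq_succ (c p)
        simp only [Finset.mem_filter, Finset.mem_univ, true_and]
        split_ifs <;> omega }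
  refine Fintype.sum_equiv e _ _ fun S => ?_
  have h0 : List.ofFn (subword S x) = block (e S) x 0 := by
    rw [ofFn_subword, block]
    congr 2
    funext p
    by_cases hp : p ∈ S <;> simp [e, hp]
  have h1 : List.ofFn (subword Sᶜ x) = block (e S) x 1 := by
    rw [ofFn_subword, block]
    congr 2
    funext p
    by_cases hp : p ∈ S <;> simp [e, hp]
  rw [h0, h1, unshuffleSign]
  congr 1
  unfold koszulSign
  refine Finset.prod_congr rfl fun p _ => Finset.prod_congr rfl fun q _ => ?_
  by_cases hp : p ∈ S <;> by_cases hq : q ∈ S <;> simp [e, hp, hq]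

end Blocks

/-! ### Comparison of the operations on words with the operations on families -/

section Powers

variable {L L' W W' : Type*} [AddCommGroup W] [AddCommGroup W']

/-- The part of `j! • comp h f` which is of arity `j` in `h`. -/
def powComp : ℕ → (Word L' → W) → (Word L → L') → Word L → W
  | 0, h, _, [] => h []
  | 0, _, _, _ :: _ => 0
  | j + 1, h, f, w => splitSum w fun s t => powComp j (fun u => h ((deg s, f s) :: u)) f t

theorem powComp_map (A : W →+ W') (j : ℕ) (h : Word L' → W) (f : Word L → L') (w : Word L) :
    powComp j (fun u => A (h u)) f w = A (powComp j h f w) := by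
  induction j generalizing h w with
  | zero => cases w <;> simp [powComp]
  | succ j ih => simp only [powComp, ih, splitSum_map]

theorem powComp_zero (j : ℕ) (f : Word L → L') (w : Word L) :
    powComp j (fun _ => (0 : W)) f w = 0 :=
  powComp_map (0 : W →+ W) j (fun _ => 0) f w

theorem powComp_smul {R : Type*} [Monoid R] [DistribMulAction R W] (c : R) (j : ℕ)
    (h : Word L' → W) (f : Word L → L') (w : Word L) :
    powComp j (fun u => c • h u) f w = c • powComp j h f w :=
  powComp_map (DistribSMul.toAddMonoidHom W c) j h f w

/-- The first letter may lie in any of the `j + 1` ordered blocks. Symmetry of `h` moves that block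
to the front, so all positions contribute equally. -/
theorem powComp_succ_cons {h : Word L' → W} (hh : IsSwapSymm h) (f : Word L → L') (j : ℕ)
    (a : ℤ × L) (w : Word L) : powComp (j + 1) h f (a :: w) =
      (j + 1) • splitSum w fun s t => powComp j (fun u => h ((deg (a :: s), f (a :: s)) :: u)) f t := by
  induction j generalizing h w with
  | zero =>
    rw [powComp, splitSum_cons]
    simp [powComp, splitSum_zero]
  | succ j ih =>
    rw [powComp, splitSum_cons]
    simp only [ih (hh.cons _)]
    rw [add_comm (j + 1), add_smul, one_smul, add_right_inj]
    simp only [smul_comm (_ : ℤˣ) (j + 1), splitSum_smul]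
    congr 1
    simp only [powComp, ← splitSum_smul]
    rw [splitSum_left_comm]
    refine splitSum_congr fun s r _ => splitSum_congr fun s' t _ => ?_
    have h1 : (fun u => h ((deg s', f s') :: (deg (a :: s), f (a :: s)) :: u)) =
        fun u => Int.negOnePow (deg s' * deg (a :: s)) •
          h ((deg (a :: s), f (a :: s)) :: (deg s', f s') :: u) :=
      funext fun u => hh [] _ _ u
    rw [h1, powComp_smul, smul_smul, smul_smul, ← Int.negOnePow_add, ← Int.negOnePow_add]
    rw [negOnePow_congr (y := 0) (deg s' * deg (a :: s)) (by rw [deg_cons]; ring)]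
    simp

end Powers

section Comparison

variable {K : Type*} [Field K] {L W : Type*} [AddCommGroup W] [Module K W]
  [AddCommGroup L] [Module K L] {p : ℤ → L →ₗ[K] L}

theorem powComp_eq_zero {h : Word L → W} (hh : IsMultilin p h) {f : Word L → L}
    (hf : f [] = 0) {j : ℕ} {w : Word L} (hj : w.length < j) : powComp j h f w = 0 := by
  induction j generalizing h w with
  | zero => simp at hj
  | succ j ih =>
    refine splitSum_eq_zero fun s t hst => ?_
    cases s with
    | nil =>
      have h1 : (fun u => h ((deg ([] : Word L), f []) :: u)) = fun _ => 0 :=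
        funext fun u => by rw [hf]; exact hh.map_zero [] _ u
      rw [h1, powComp_zero]
    | cons a s =>
      refine ih (hh.cons _) ?_
      have := hst.length_eq
      simp at this
      omega

/-- By `powComp_succ_cons`, the factor `1 / j!` cancels the orderings of the blocks and leaves the
one by first letters. -/
theorem comp_eq_sum_powComp [CharZero K] {h : Word L → W} (hh : IsSymmMultilin p h)
    {f : Word L → L} (hf : f [] = 0) (w : Word L) : comp h f w =
      ∑ j ∈ Finset.range (w.length + 1), ((j.factorial : K)⁻¹) • powComp j h f w := by
  induction w using word_induction generalizing h with
  | nil => simp [powComp]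
  | cons a w ih =>
    rw [List.length_cons, Finset.sum_range_succ', comp_cons]
    simp only [powComp_succ_cons hh.2]
    have h1 : powComp 0 h f (a :: w) = 0 := rfl
    rw [h1, smul_zero, add_zero]
    have h2 : ∀ j : ℕ, (((j + 1).factorial : K)⁻¹) • (j + 1) • splitSum w (fun s t =>
        powComp j (fun u => h ((deg (a :: s), f (a :: s)) :: u)) f t) =
        splitSum w (fun s t => ((j.factorial : K)⁻¹) •
          powComp j (fun u => h ((deg (a :: s), f (a :: s)) :: u)) f t) := fun j => by
      rw [splitSum_smul, ← Nat.cast_smul_eq_nsmul K, smul_smul]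
      congr 1
      rw [Nat.factorial_succ]
      have : ((j + 1 : ℕ) : K) ≠ 0 := by exact_mod_cast Nat.succ_ne_zero j
      have : (j.factorial : K) ≠ 0 := by exact_mod_cast Nat.factorial_ne_zero j
      push_cast at *
      field_simp
    simp only [h2, ← splitSum_sum]
    refine splitSum_congr fun s t hst => ?_
    rw [ih t (length_right_le hst) (hh.cons _)]
    refine Finset.sum_subset (Finset.range_subset_range.2
      (Nat.succ_le_succ (length_right_le hst))) fun j _ hj => ?_
    rw [powComp_eq_zero (hh.cons _).1 hf (by simpa using hj), smul_zero]

theorem evalWord_cons_fixed (h : Family K L W) {k : ℤ} {x : L} (hx : p k x = x) (w : Word L) :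
    evalWord p h ((k, x) :: w) = evalWord p (fun n => (h (n + 1)).curryLeft x) w := by
  rw [evalWord, hx]

theorem blockSum_eq_powComp (h : Family K L W) {f : Word L → L} (hf : HasWordDegree p 0 f)
    (j : ℕ) (w : Word L) :
    blockSum j w (fun B => h j fun i => f (B i)) = powComp j (evalWord p h) f w := by
  induction j generalizing h w with
  | zero =>
    cases w with
    | nil => exact congrArg (h 0) (Subsingleton.elim _ _)
    | cons a w => exact blockSum_zero_cons _ _ _
  | succ j ih =>
    rw [blockSum_succ, powComp]
    refine splitSum_congr fun s t _ => ?_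
    have h1 := hf s
    rw [add_zero] at h1
    simp only [evalWord_cons_fixed h h1, ← ih]
    congr 1
    funext B
    rw [MultilinearMap.curryLeft_apply]
    congr 1
    funext i
    refine Fin.cases ?_ (fun i => ?_) i <;> simp

variable {𝓐 : ℤ → Submodule K L}

theorem apply_subword_eq (hp : ∀ k, ∀ x ∈ 𝓐 k, p k x = x) (f : Family K L W) {n : ℕ}
    {d : Fin n → ℤ} {a : Fin n → L} (ha : IsHomog 𝓐 d a) (S : Finset (Fin n)) :
    f S.card (subword S a) =
      evalWord p f (List.ofFn (subword S fun i => (d i, a i))) := by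
  rw [evalWord_ofFn]
  congr 1
  funext i
  exact (hp _ _ (ha _)).symm

theorem apply_eq_evalWord (hp : ∀ k, ∀ x ∈ 𝓐 k, p k x = x) (f : Family K L W) {n : ℕ}
    {d : Fin n → ℤ} {a : Fin n → L} (ha : IsHomog 𝓐 d a) :
    f n a = evalWord p f (List.ofFn fun i => (d i, a i)) := by
  rw [evalWord_ofFn]
  congr 1
  funext i
  exact (hp _ _ (ha _)).symm

theorem compOp_eq_comp [CharZero K] (hp : ∀ k, ∀ x ∈ 𝓐 k, p k x = x) (hp' : ∀ k x, p k x ∈ 𝓐 k)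
    {h : Family K L W} (hh : IsGradedSymm 𝓐 h) {f : Family K L L} (hf0 : f 0 = 0)
    (hf : HasWordDegree p 0 (evalWord p f)) {n : ℕ} {d : Fin n → ℤ} {a : Fin n → L}
    (ha : IsHomog 𝓐 d a) :
    compOp h f d a = comp (evalWord p h) (evalWord p f) (List.ofFn fun i => (d i, a i)) := by
  have hf0' : evalWord p f [] = 0 := by simp [evalWord, hf0]
  rw [comp_eq_sum_powComp (isSymmMultilin_evalWord hp' hh) hf0', List.length_ofFn, compOp]
  refine Finset.sum_congr rfl fun j _ => ?_
  rw [← blockSum_eq_powComp h hf, ← sum_koszulSign (fun i => (d i, a i))]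
  congr 1
  have h1 : ∀ (c : Fin n → Fin j) i, f _ (subword {p : Fin n | c p = i} a) =
      evalWord p f (block c (fun i => (d i, a i)) i) := fun c i => by
    rw [apply_subword_eq hp f ha, ofFn_subword_colour]
  simp only [h1]
  -- Colourings that are not surjective have an empty block and contribute zero, since `f 0 = 0`.
  refine Finset.sum_subset (Finset.filter_subset _ _) fun c _ hc => ?_
  have h2 : ¬ Function.Surjective c := by simpa using hc
  obtain ⟨i, hi⟩ : ∃ i, ∀ q, c q ≠ i := by simpa [Function.Surjective] using h2
  have h3 : block c (fun i => (d i, a i)) i = [] := by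
    simp [block, hi]
  rw [(h j).map_coord_zero i (by rw [h3, hf0']), smul_zero]

theorem insertOp_eq_insert (hp : ∀ k, ∀ x ∈ 𝓐 k, p k x = x)
    (h : Family K L W) {q : Family K L L} (hq0 : q 0 = 0)
    (hq : HasWordDegree p 1 (evalWord p q)) {n : ℕ} {d : Fin n → ℤ} {a : Fin n → L}
    (ha : IsHomog 𝓐 d a) :
    insertOp h q d a = insert (evalWord p h) (evalWord p q) (List.ofFn fun i => (d i, a i)) := by
  rw [insert, ← sum_unshuffleSign, insertOp]
  have h1 : ∀ S : Finset (Fin n), h (Sᶜ.card + 1) (Fin.cons (q S.card (subword S a))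
      (subword Sᶜ a)) = evalWord p h ((deg (List.ofFn (subword S fun i => (d i, a i))) + 1,
        evalWord p q (List.ofFn (subword S fun i => (d i, a i)))) ::
          List.ofFn (subword Sᶜ fun i => (d i, a i))) := fun S => by
    rw [evalWord_cons_fixed h (hq _), ← apply_subword_eq hp q ha,
      ← apply_subword_eq hp (fun n => (h (n + 1)).curryLeft _) ha, MultilinearMap.curryLeft_apply]
  simp only [h1]
  -- The word recursion also inserts the value on the empty subword, which is zero because `q 0 =
  -- 0`.
  refine Finset.sum_subset (Finset.filter_subset _ _) fun S _ hS => ?_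
  obtain rfl : S = ∅ := by simpa using hS
  have h2 : q (∅ : Finset (Fin n)).card (subword ∅ a) = 0 := by
    simp only [Finset.card_empty]
    rw [hq0]; rfl
  rw [← h1, h2, (h _).map_coord_zero 0 rfl, smul_zero]

/-- The convolution product of functions of words, where the right factor is odd. -/
def act {X R : Type*} [Ring R] (φ ψ : Word X → R) (w : Word X) : R :=
  splitSum w fun s t => Int.negOnePow (deg s) • (φ s * ψ t)

theorem actOp_eq_act {V : Type*} [AddCommGroup V] [Module K V]
    (hp : ∀ k, ∀ x ∈ 𝓐 k, p k x = x) (φ ψ : Family K L (Module.End K V)) {n : ℕ}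
    {d : Fin n → ℤ} {a : Fin n → L} (ha : IsHomog 𝓐 d a) :
    actOp φ ψ d a = act (evalWord p φ) (evalWord p ψ) (List.ofFn fun i => (d i, a i)) := by
  rw [act, ← sum_unshuffleSign, actOp]
  refine Finset.sum_congr rfl fun S _ => ?_
  rw [apply_subword_eq hp φ ha, apply_subword_eq hp ψ ha, mul_smul]
  congr 3
  rw [deg, List.map_ofFn, List.sum_ofFn]
  exact ((S.sum_coe_sort d).symm.trans (Equiv.sum_comp (S.orderIsoOfFin rfl).toEquiv _).symm)

/-- The sign depends only on the degree of the left subword, which composition preserves, so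
compatibility with unshuffling carries over to the signed product. -/
theorem comp_act {X R : Type*} [Ring R] (φ ψ : Word X → R) (f : Word X → X) (w : Word X) :
    comp (act φ ψ) f w = act (comp φ f) (comp ψ f) w := by
  unfold act
  rw [comp_splitSum]
  refine splitSum_congr fun s t _ => ?_
  have h1 : ∀ u, comp (fun v => Int.negOnePow (deg u) • (φ u * ψ v)) f t =
      Int.negOnePow (deg u) • (φ u * comp ψ f t) := fun u => by
    rw [comp_smul]
    congr 1
    exact comp_map_const (AddMonoidHom.mulLeft (φ u)) ψ f t
  simp only [h1]
  rw [comp_smul_deg]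
  congr 1
  exact comp_map_const (AddMonoidHom.mulRight (comp ψ f t)) φ f s

end Comparison

/-! ### Transport of structures along unipotent morphisms -/

section TransportFamilies

variable {K : Type*} [Field K] {L W : Type*} [AddCommGroup W] [Module K W]
  [AddCommGroup L] [Module K L]

/-- `p k` is the projection to the part of degree `k`, and only degrees in `I` occur. -/
structure IsProjection (𝓐 : ℤ → Submodule K L) (p : ℤ → L →ₗ[K] L) (I : Finset ℤ) : Prop where
  mem : ∀ k x, p k x ∈ 𝓐 k
  apply_of_mem : ∀ k, ∀ x ∈ 𝓐 k, p k x = x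
  apply_ne : ∀ j k x, j ≠ k → p j (p k x) = 0
  eq_zero : ∀ k, k ∉ I → p k = 0

variable {p : ℤ → L →ₗ[K] L} {I : Finset ℤ}

theorem IsProjection.idem {𝓐 : ℤ → Submodule K L} (hp : IsProjection 𝓐 p I) (k : ℤ) (x : L) :
    p k (p k x) = p k x :=
  hp.apply_of_mem k _ (hp.mem k x)

theorem deg_ofFn {L : Type*} {n : ℕ} (d : Fin n → ℤ) (a : Fin n → L) :
    deg (List.ofFn fun i => (d i, a i)) = ∑ i, d i := by
  rw [deg, List.map_ofFn, List.sum_ofFn]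
  rfl

theorem exists_eq_ofFn {L : Type*} (w : Word L) : ∃ (n : ℕ) (d : Fin n → ℤ) (a : Fin n → L),
    w = List.ofFn fun i => (d i, a i) :=
  ⟨_, fun i => (w.get i).1, fun i => (w.get i).2, (List.ofFn_get w).symm⟩

variable {𝓐 : ℤ → Submodule K L}

theorem IsProjection.eq_zero_of_homog (hp : IsProjection 𝓐 p I) {H : Word L → W}
    (hH : IsMultilin p H) (h : ∀ (n : ℕ) (d : Fin n → ℤ) (a : Fin n → L), IsHomog 𝓐 d a →
      H (List.ofFn fun i => (d i, a i)) = 0) : H = fun _ => 0 := by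
  funext w
  obtain ⟨n, d, a, rfl⟩ := exists_eq_ofFn w
  rw [← hH.map_proj hp.idem, List.map_ofFn]
  exact h n d (fun i => p (d i) (a i)) fun i => hp.mem _ _

theorem IsProjection.hasWordDegree (hp : IsProjection 𝓐 p I) {r : ℤ} {h : Family K L L}
    (hh : HasDegree 𝓐 𝓐 r h) : HasWordDegree p r (evalWord p h) := by
  intro w
  obtain ⟨n, d, a, rfl⟩ := exists_eq_ofFn w
  rw [evalWord_ofFn, deg_ofFn]
  exact hp.apply_of_mem _ _ (hh n d _ fun i => hp.mem _ _)

theorem IsProjection.hasDegree (hp : IsProjection 𝓐 p I) {r : ℤ} {h : Family K L L}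
    (hh : HasWordDegree p r (evalWord p h)) : HasDegree 𝓐 𝓐 r h := by
  intro n d a ha
  rw [apply_eq_evalWord hp.apply_of_mem h ha, ← hh, deg_ofFn]
  exact hp.mem _ _

theorem family_zero_eq_zero {h : Family K L W}
    (hh : evalWord p h [] = 0) : h 0 = 0 := by
  ext a
  rw [Subsingleton.elim a ![]]
  exact hh

theorem IsMultilin.act {R : Type*} [Ring R] [Algebra K R] {φ ψ : Word L → R}
    (hφ : IsMultilin p φ) (hψ : IsMultilin p ψ) : IsMultilin p (LInfty.act φ ψ) := by
  intro u k v
  refine .splitSum_append (fun s s' t => ?_) (fun s t t' => ?_) u v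
  · simp only [deg_append, deg_cons]
    exact ((hφ s k s').map (LinearMap.mulRight K (ψ t))).units_smul _
  · exact ((hψ t k t').map (LinearMap.mulLeft K (φ s))).units_smul _

end TransportFamilies

section Structures

variable {K : Type*} [Field K] [CharZero K] {M : Type*} [AddCommGroup M] [Module K M]
  {𝓜 : ℤ → Submodule K M} {p : ℤ → M →ₗ[K] M} {I : Finset ℤ}

/-- The transported data are constructed as functions of words and turned into families by
`toFamily`; each axiom is then an identity of words. The module relation over `A'` is the relation
over `A` composed with `g`. -/
theorem exists_transport (hp : IsProjection (shift 𝓜) p I) (A : LAlgebra 𝓜) {f : Word M → M}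
    (hf : IsUnipotent p f) {V : Type*} [AddCommGroup V] [Module K V] {𝓥 : ℤ → Submodule K V}
    (B : LModule A 𝓥) :
    ∃ (A' : LAlgebra 𝓜) (F : LHom A A') (G : LHom A' A) (B' : LModule A' 𝓥) (g : Word M → M),
      F.IsInverse G ∧ B'.IsPullback G B ∧ IsUnipotent p g ∧ comp f g = idWord p ∧
      evalWord p B'.φ = comp (evalWord p B.φ) g := by
  have hid := hp.idem
  have hpm := hp.apply_of_mem
  obtain ⟨g, hg, hgf, hfg⟩ := hf.exists_inverse hid
  have hq : IsSymmMultilin p (evalWord p A.q) := isSymmMultilin_evalWord hp.mem A.symm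
  have hqd : HasWordDegree p 1 (evalWord p A.q) := hp.hasWordDegree A.degree
  have hqq : insert (evalWord p A.q) (evalWord p A.q) = fun _ => 0 :=
    hp.eq_zero_of_homog (hq.1.insert hq.1) fun n d a ha => by
      rw [← insertOp_eq_insert hpm _ A.q_zero hqd ha, A.jacobi n d a ha]
  have hφ : IsSymmMultilin p (evalWord p B.φ) := isSymmMultilin_evalWord hp.mem B.symm
  have hrel : (fun w => insert (evalWord p B.φ) (evalWord p A.q) w +
      act (evalWord p B.φ) (evalWord p B.φ) w) = fun _ => 0 :=
    hp.eq_zero_of_homog ((hφ.1.insert hq.1).add (hφ.1.act hφ.1)) fun n d a ha => by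
      rw [← insertOp_eq_insert hpm _ A.q_zero hqd ha, ← actOp_eq_act hpm _ _ ha, B.rel n d a ha]
  set q' := transport f g (evalWord p A.q) with hq'def
  have hq' : IsSymmMultilin p q' := (hf.1.insert hq).comp hg.1
  have hq'd : HasWordDegree p 1 q' := by
    have := (hf.2.insert (evalWord p A.q)).comp g
    rwa [zero_add] at this
  have hq'0 : q' [] = 0 := by
    have : evalWord p A.q [] = 0 := by simp [evalWord, A.q_zero]
    simp only [hq'def, transport, comp_nil, insert, splitSum_nil, this]
    exact hf.1.1.map_zero [] _ []
  have hfe : evalWord p (hf.1.1.toFamily I) = f := evalWord_toFamily hp.eq_zero hid hp.apply_ne _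
  have hge : evalWord p (hg.1.1.toFamily I) = g := evalWord_toFamily hp.eq_zero hid hp.apply_ne _
  have hqe : evalWord p (hq'.1.toFamily I) = q' := evalWord_toFamily hp.eq_zero hid hp.apply_ne _
  have hφe : evalWord p ((hφ.comp hg.1).1.toFamily I) = comp (evalWord p B.φ) g :=
    evalWord_toFamily hp.eq_zero hid hp.apply_ne _
  have hqs : IsGradedSymm (shift 𝓜) (hq'.1.toFamily I) :=
    isGradedSymm_of_evalWord hpm (by rw [hqe]; exact hq'.2)
  have hq0 : (hq'.1.toFamily I) 0 = 0 := family_zero_eq_zero (p := p) (by rw [hqe, hq'0])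
  have hqd' : HasWordDegree p 1 (evalWord p (hq'.1.toFamily I)) := by rw [hqe]; exact hq'd
  have hf0 : (hf.1.1.toFamily I) 0 = 0 :=
    family_zero_eq_zero (p := p) (by rw [hfe, hf.map_nil])
  have hg0 : (hg.1.1.toFamily I) 0 = 0 :=
    family_zero_eq_zero (p := p) (by rw [hge, hg.map_nil])
  have hfs : IsGradedSymm (shift 𝓜) (hf.1.1.toFamily I) :=
    isGradedSymm_of_evalWord hpm (by rw [hfe]; exact hf.1.2)
  have hgs : IsGradedSymm (shift 𝓜) (hg.1.1.toFamily I) :=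
    isGradedSymm_of_evalWord hpm (by rw [hge]; exact hg.1.2)
  have hfd : HasWordDegree p 0 (evalWord p (hf.1.1.toFamily I)) := by rw [hfe]; exact hf.2
  have hgd : HasWordDegree p 0 (evalWord p (hg.1.1.toFamily I)) := by rw [hge]; exact hg.2
  have hgq := insert_transport hid hf hg hgf hfg hq hqd
  let A' : LAlgebra 𝓜 :=
    { q := hq'.1.toFamily I
      q_zero := hq0
      symm := hqs
      degree := hp.hasDegree hqd'
      jacobi := fun n d a ha => by
        rw [insertOp_eq_insert hpm _ hq0 hqd' ha, hqe, hq'def,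
          insert_transport_transport hid hf hg hgf hfg hq hqd hqq] }
  let F : LHom A A' :=
    { f := hf.1.1.toFamily I
      f_zero := hf0
      symm := hfs
      degree := hp.hasDegree hfd
      compat := fun n d a ha => by
        rw [compOp_eq_comp hpm hp.mem hqs hf0 hfd ha, insertOp_eq_insert hpm _ A.q_zero hqd ha, hqe,
          hfe, comp_transport hid hf hgf hq] }
  let G : LHom A' A :=
    { f := hg.1.1.toFamily I
      f_zero := hg0
      symm := hgs
      degree := hp.hasDegree hgd
      compat := fun n d a ha => by
        rw [compOp_eq_comp hpm hp.mem A.symm hg0 hgd ha, insertOp_eq_insert hpm _ hq0 hqd' ha, hqe,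
          hge, hgq] }
  have hidT : ∀ (n : ℕ) (d : Fin n → ℤ) (a : Fin n → M), IsHomog (shift 𝓜) d a →
      idWord p (List.ofFn fun i => (d i, a i)) = idTaylor a := by
    intro n d a ha
    rcases n with _ | _ | n
    · rfl
    · simpa [idTaylor, idWord] using hpm _ _ (ha 0)
    · simp [idTaylor, idWord]
  let B' : LModule A' 𝓥 :=
    { φ := (hφ.comp hg.1).1.toFamily I
      symm := isGradedSymm_of_evalWord hpm (by rw [hφe]; exact (hφ.comp hg.1).2)
      degree := fun n d a ha e v hv => by
        -- Endomorphisms raising the degree by `k + 1`; composition stays in these subgroups.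
        let P : ℤ → AddSubgroup (Module.End K V) := fun k =>
          { carrier := {T | ∀ e, ∀ v ∈ 𝓥 e, T v ∈ 𝓥 (k + e + 1)}
            add_mem' := fun h h' e v hv => (𝓥 _).add_mem (h e v hv) (h' e v hv)
            zero_mem' := fun e v hv => (𝓥 _).zero_mem
            neg_mem' := fun h e v hv => (𝓥 _).neg_mem (h e v hv) }
        have h1 := comp_mem (P := P) (h := evalWord p B.φ) g (fun u => by
          obtain ⟨n, d, a, rfl⟩ := exists_eq_ofFn u
          rw [evalWord_ofFn, deg_ofFn]
          exact B.degree n d _ fun i => hp.mem _ _) (List.ofFn fun i => (d i, a i))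
        rw [deg_ofFn] at h1
        rw [apply_eq_evalWord hpm _ ha, hφe]
        exact h1 e v hv
      rel := fun n d a ha => by
        rw [insertOp_eq_insert hpm _ hq0 hqd' ha, actOp_eq_act hpm _ _ ha, hqe, hφe, ← comp_act,
          insert_comp hφ.1.isAdditive hgq, ← comp_add, hrel, comp_zero] }
  refine ⟨A', F, G, B', g, ⟨fun n d a ha => ?_, fun n d a ha => ?_⟩, fun n d a ha => ?_, hg, hfg,
    hφe⟩
  · rw [compOp_eq_comp hpm hp.mem hgs hf0 hfd ha, hfe, hge, hgf, hidT n d a ha]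
  · rw [compOp_eq_comp hpm hp.mem hfs hg0 hgd ha, hfe, hge, hfg, hidT n d a ha]
  · rw [compOp_eq_comp hpm hp.mem B.symm hg0 hgd ha, hge, apply_eq_evalWord hpm _ ha, hφe]

end Structures

/-! ### The section of the action map and the linearizing morphism -/

section Linearization

variable {K : Type*} [Field K] {M : Type*} [AddCommGroup M] [Module K M]

/-- The projection of a graded vector space to its part of degree `k`. -/
def homogProj (𝓜 : ℤ → Submodule K M) [DirectSum.Decomposition 𝓜] (k : ℤ) : M →ₗ[K] 𝓜 k :=
  DirectSum.component K ℤ (fun i => 𝓜 i) k ∘ₗ (DirectSum.decomposeLinearEquiv 𝓜).toLinearMap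

theorem homogProj_of_mem (𝓜 : ℤ → Submodule K M) [DirectSum.Decomposition 𝓜] {k : ℤ} {x : M}
    (hx : x ∈ 𝓜 k) : (homogProj 𝓜 k x : M) = x :=
  DirectSum.decompose_of_mem_same 𝓜 hx

theorem homogProj_of_mem_ne (𝓜 : ℤ → Submodule K M) [DirectSum.Decomposition 𝓜] {j k : ℤ} {x : M}
    (hx : x ∈ 𝓜 k) (h : j ≠ k) : (homogProj 𝓜 j x : M) = 0 :=
  DirectSum.decompose_of_mem_ne 𝓜 hx h.symm

theorem isProjection_homogProj (𝓜 : ℤ → Submodule K M) [DirectSum.Decomposition 𝓜]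
    (hM : ∀ i : ℤ, i ≠ 0 → i ≠ 1 → 𝓜 i = ⊥) :
    IsProjection (shift 𝓜) (fun k => (𝓜 (k + 1)).subtype ∘ₗ homogProj 𝓜 (k + 1)) {-1, 0} where
  mem k x := (homogProj 𝓜 (k + 1) x).2
  apply_of_mem k x hx := homogProj_of_mem 𝓜 hx
  apply_ne j k x h := homogProj_of_mem_ne 𝓜 (homogProj 𝓜 (k + 1) x).2 (by simpa using h)
  eq_zero k hk := by
    have hk' : k ≠ -1 ∧ k ≠ 0 := by simpa using hk
    ext x
    have h : ∀ y ∈ 𝓜 (k + 1), y = 0 := by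
      rw [hM (k + 1) (by omega) (by omega)]
      simp
    exact h _ (homogProj 𝓜 (k + 1) x).2

variable {𝓜 : ℤ → Submodule K M} [DirectSum.Decomposition 𝓜] {A : LAlgebra 𝓜}
  {V : Type*} [AddCommGroup V] [Module K V] {𝓥 : ℤ → Submodule K V}

theorem LModule.mTwo_apply (B : LModule A 𝓥) (a : 𝓜 1) (v : 𝓥 0) :
    (B.mTwo a v : V) = -(B.φ 1 (fun _ => (a : M)) v) := by
  have hs : signOp 𝓜 (a : M) = a := by rw [signOp_of_mem 𝓜 a.2]; simp
  change B.m 1 (fun _ => (a : M)) (v : V) = _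
  simp [LModule.m, hs]

/-- The map `π` factors as the canonical `θ` followed by the dual of `mTwo`. Injectivity passes to
`θ`, which is then bijective by equality of dimensions, so the dual of `mTwo` is injective too. -/
theorem LModule.mTwo_surjective [Module.Finite K M] [Module.Finite K V] (B : LModule A 𝓥)
    (hπ : Function.Injective B.pi) : Function.Surjective B.mTwo := by
  let θ : 𝓥 0 ⊗[K] Module.Dual K (𝓥 1) →ₗ[K] Module.Dual K (𝓥 0 →ₗ[K] 𝓥 1) :=
    TensorProduct.lift (LinearMap.mk₂ K (fun v ξ => ξ ∘ₗ LinearMap.applyₗ v)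
      (fun v v' ξ => by ext; simp) (fun r v ξ => by ext; simp)
      (fun v ξ ξ' => by ext; simp) (fun r v ξ => by ext; simp))
  have h1 : B.pi = B.mTwo.dualMap ∘ₗ θ := by
    ext v ξ a
    simp [θ, LModule.pi]
  have h2 : Function.Injective θ := by
    rw [h1, LinearMap.coe_comp] at hπ
    exact hπ.of_comp
  have h3 : Function.Surjective θ := by
    refine (LinearMap.injective_iff_surjective_of_finrank_eq_finrank ?_).1 h2
    simp [Module.finrank_tensorProduct, Subspace.dual_finrank_eq, Module.finrank_linearMap]
  rw [← LinearMap.dualMap_injective_iff]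
  rw [h1, LinearMap.coe_comp] at hπ
  exact Function.Injective.of_comp_right hπ h3

theorem LModule.exists_section [DirectSum.Decomposition 𝓥] [Module.Finite K M] [Module.Finite K V]
    (B : LModule A 𝓥) (hπ : Function.Injective B.pi) :
    ∃ S : Module.End K V →ₗ[K] M, (∀ T, S T ∈ 𝓜 1) ∧
      ∀ T : Module.End K V, (∀ v ∈ 𝓥 0, T v ∈ 𝓥 1) →
        ∀ v ∈ 𝓥 0, B.φ 1 (fun _ => S T) v = T v := by
  obtain ⟨s, hs⟩ := LinearMap.exists_rightInverse_of_surjective B.mTwo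
    (LinearMap.range_eq_top.2 (B.mTwo_surjective hπ))
  let R : Module.End K V →ₗ[K] (𝓥 0 →ₗ[K] 𝓥 1) :=
    { toFun := fun T => homogProj 𝓥 1 ∘ₗ T ∘ₗ (𝓥 0).subtype
      map_add' := fun T T' => by ext; simp
      map_smul' := fun c T => by ext; simp }
  -- The minus sign compensates `m_2 = -φ_2` on `M^1`. Restricting and projecting by `R` makes the
  -- section defined on all endomorphisms.
  refine ⟨(𝓜 1).subtype ∘ₗ s ∘ₗ (-R), fun T => (s (-R T)).2, fun T hT v hv => ?_⟩
  have h1 : B.mTwo (s (-R T)) = -R T := LinearMap.congr_fun hs (-R T)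
  have h2 := B.mTwo_apply (s (-R T)) ⟨v, hv⟩
  rw [h1] at h2
  have h3 : (R T ⟨v, hv⟩ : V) = T v := homogProj_of_mem 𝓥 (hT v hv)
  simp only [LinearMap.neg_apply, Submodule.coe_neg, neg_inj, h3] at h2
  exact h2.symm

/-- The Taylor coefficients `id + S ∘ φ_n`, `n ≥ 2`, on words of letters of degree zero. -/
def linearizer (p : ℤ → M →ₗ[K] M) {W : Type*} [AddCommGroup W] [Module K W] (S : W →ₗ[K] M)
    (φ : Word M → W) (w : Word M) : M :=
  idWord p w + if 2 ≤ w.length ∧ ∀ a ∈ w, a.1 = 0 then S (φ w) else 0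

theorem deg_eq_zero {X : Type*} {w : Word X} (h : ∀ a ∈ w, a.1 = 0) : deg w = 0 := by
  refine List.sum_eq_zero fun k hk => ?_
  obtain ⟨a, ha, rfl⟩ := List.mem_map.1 hk
  exact h a ha

theorem isUnipotent_linearizer {p : ℤ → M →ₗ[K] M} (hp : ∀ k x, p k (p k x) = p k x)
    {W : Type*} [AddCommGroup W] [Module K W] {S : W →ₗ[K] M} (hS : ∀ T, p 0 (S T) = S T)
    {φ : Word M → W} (hφ : IsSymmMultilin p φ) : IsUnipotent p (linearizer p S φ) := by
  refine ⟨.add .idWord ⟨fun u k v => ?_, fun u a b v => ?_⟩, fun w => ?_, ?_, fun a => ?_⟩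
  · by_cases h : 2 ≤ (u ++ (k, (0 : M)) :: v).length ∧ ∀ a ∈ u ++ (k, (0 : M)) :: v, a.1 = 0
    · refine (congrArg _ (funext fun x => ?_)).mp ((hφ.1 u k v).map S)
      rw [if_pos]
      simpa [or_imp, forall_and] using h
    · refine (congrArg _ (funext fun x => ?_)).mp FactorsThrough.zero
      rw [if_neg]
      simpa [or_imp, forall_and] using h
  · have h : (2 ≤ (u ++ a :: b :: v).length ∧ ∀ x ∈ u ++ a :: b :: v, x.1 = 0) ↔
        (2 ≤ (u ++ b :: a :: v).length ∧ ∀ x ∈ u ++ b :: a :: v, x.1 = 0) := by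
      simp only [List.length_append, List.length_cons, List.mem_append, List.mem_cons]
      grind
    simp only [h]
    split_ifs
    · exact (hφ.map S).2 u a b v
    · exact (smul_zero _).symm
  · have h1 := (IsUnipotent.idWord hp).degree w
    unfold linearizer
    rw [map_add, h1]
    congr 1
    split_ifs with h
    · rw [deg_eq_zero h.2, add_zero, hS]
    · exact map_zero _
  · simp [linearizer, idWord]
  · simp [linearizer, idWord]

/-- The restriction of a function of words to words of length at most one. -/
def truncateOne {M W : Type*} [AddCommGroup W] (φ : Word M → W) (w : Word M) : W :=
  if w.length ≤ 1 then φ w else 0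

theorem isMultilin_truncateOne {p : ℤ → M →ₗ[K] M} {W : Type*} [AddCommGroup W] [Module K W]
    {φ : Word M → W} (hφ : IsMultilin p φ) : IsMultilin p (truncateOne φ) := by
  intro u k v
  by_cases h : (u ++ (k, (0 : M)) :: v).length ≤ 1
  · refine (congrArg _ (funext fun x => ?_)).mp (hφ u k v)
    rw [truncateOne, if_pos (by simpa using h)]
  · refine (congrArg _ (funext fun x => ?_)).mp FactorsThrough.zero
    rw [truncateOne, if_neg (by simpa using h)]

theorem comp_truncateOne {M X W : Type*} [AddCommGroup W] (φ : Word M → W) (f : Word X → M)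
    (a : ℤ × X) (w : Word X) :
    comp (truncateOne φ) f (a :: w) = φ [(deg (a :: w), f (a :: w))] := by
  rw [comp_cons, splitSum_right_nil]
  · rfl
  · intro s t ht _
    obtain ⟨b, t, rfl⟩ := List.exists_cons_of_ne_nil ht
    rw [comp_cons]
    refine splitSum_eq_zero fun s' t' _ => ?_
    have : ∀ x y : ℤ × M, (fun u => truncateOne φ (x :: y :: u)) = fun _ => 0 := fun x y => by
      funext u
      simp [truncateOne]
    rw [this, comp_zero]

/-- The truncation sees only the one-block partition of a nonempty word, that is, a single value of
the linearizer. For at least two letters this is `S (φ w)`, from which the linear action recovers `φ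
w` after applying `R`; a single letter is unchanged up to projection. -/
theorem comp_truncateOne_linearizer {p : ℤ → M →ₗ[K] M} (hp : ∀ k x, p k (p k x) = p k x)
    {W W' : Type*} [AddCommGroup W] [Module K W] [AddCommGroup W'] [Module K W']
    {S : W →ₗ[K] M} {φ : Word M → W} (hφ : IsMultilin p φ) (R : W →ₗ[K] W')
    (hS : ∀ w, (∀ a ∈ w, a.1 = 0) → R (φ [(0, S (φ w))]) = R (φ w)) {w : Word M}
    (hw : ∀ a ∈ w, a.1 = 0) :
    comp (truncateOne fun u => R (φ u)) (linearizer p S φ) w = R (φ w) := by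
  rcases w with _ | ⟨a, w⟩
  · rfl
  rw [comp_truncateOne, deg_eq_zero hw]
  rcases w with _ | ⟨b, w⟩
  · have ha := hw a (by simp)
    obtain ⟨k, x⟩ := a
    obtain rfl : k = 0 := ha
    obtain ⟨ℓ, hl⟩ := hφ [] 0 []
    simp only [List.nil_append] at hl
    simp [linearizer, idWord, hl, hp]
  · rw [linearizer, if_pos ⟨by simp, hw⟩, idWord, zero_add, hS _ hw]
    simp

end Linearization
end LInfty

end

/-! ### The main theorem -/

theorem mainTheorem1 {K : Type*} [Field K] [CharZero K]
    {M : Type*} [AddCommGroup M] [Module K M] [Module.Finite K M]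
    {V : Type*} [AddCommGroup V] [Module K V] [Module.Finite K V]
    (𝓜 : ℤ → Submodule K M) [DirectSum.Decomposition 𝓜]
    (𝓥 : ℤ → Submodule K V) [DirectSum.Decomposition 𝓥]
    (A : LInfty.LAlgebra 𝓜) (B : LInfty.LModule A 𝓥)
    (hM : ∀ i : ℤ, i ≠ 0 → i ≠ 1 → 𝓜 i = ⊥)
    (hV : ∀ i : ℤ, i ≠ 0 → i ≠ 1 → 𝓥 i = ⊥)
    (hl : A.l 1 = 0) (hm : B.m 0 = 0)
    (hπ : Function.Injective B.pi) :
    ∃ (A' : LInfty.LAlgebra 𝓜) (F : LInfty.LHom A A') (G : LInfty.LHom A' A),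
      F.IsInverse G ∧
      ∃ B' : LInfty.LModule A' 𝓥, B'.IsPullback G B ∧
        B'.m 1 = B.m 1 ∧
        ∀ n : ℕ, 2 ≤ n → ∀ a : Fin n → M, (∀ i, a i ∈ 𝓜 1) →
          ∀ v ∈ 𝓥 0, B'.m n a v = 0 := by
  obtain ⟨S, hS1, hS2⟩ := B.exists_section hπ
  have hp := LInfty.isProjection_homogProj 𝓜 hM
  set p : ℤ → M →ₗ[K] M := fun k => (𝓜 (k + 1)).subtype ∘ₗ LInfty.homogProj 𝓜 (k + 1)
  set Φ := LInfty.evalWord p B.φ with hΦdef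
  have hΦ : LInfty.IsSymmMultilin p Φ := LInfty.isSymmMultilin_evalWord hp.mem B.symm
  have hpS : ∀ T, p 0 (S T) = S T := fun T => hp.apply_of_mem 0 _ (hS1 T)
  have hf := LInfty.isUnipotent_linearizer hp.idem hpS hΦ
  obtain ⟨A', F, G, B', g, hFG, hB', hg, hfg, hφ'⟩ := LInfty.exists_transport hp A hf B
  have hΦ1 : ∀ k, ∀ x ∈ LInfty.shift 𝓜 k, Φ [(k, x)] = B.φ 1 fun _ => x := fun k x hx =>
    (LInfty.apply_eq_evalWord hp.apply_of_mem B.φ (d := fun _ => k) (a := fun _ : Fin 1 => x)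
      fun _ => hx).symm
  -- Restriction to `V^0`: the section property holds only there.
  let R : Module.End K V →ₗ[K] (𝓥 0 →ₗ[K] V) := LinearMap.lcomp K V (𝓥 0).subtype
  have hR : ∀ w : LInfty.Word M, (∀ a ∈ w, a.1 = 0) → R (Φ [(0, S (Φ w))]) = R (Φ w) := by
    intro w hw
    ext v
    change Φ [(0, S (Φ w))] v = Φ w v
    rw [hΦ1 0 _ (hS1 _)]
    refine hS2 (Φ w) (fun v hv => ?_) v v.2
    obtain ⟨n, d, a, rfl⟩ := LInfty.exists_eq_ofFn w
    have h := B.degree n d (fun i => p (d i) (a i)) (fun i => hp.mem _ _) 0 v hv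
    rw [← LInfty.deg_ofFn d a, LInfty.deg_eq_zero hw] at h
    rw [hΦdef, LInfty.evalWord_ofFn]
    simpa using h
  have hψ := LInfty.isMultilin_truncateOne (hΦ.1.map R)
  have hlin : ∀ w : LInfty.Word M, (∀ a ∈ w, a.1 = 0) →
      R (LInfty.evalWord p B'.φ w) = LInfty.truncateOne (fun u => R (Φ u)) w := by
    intro w hw
    rw [hφ']
    have h1 := LInfty.comp_map_const R.toAddMonoidHom Φ g w
    rw [LinearMap.toAddMonoidHom_coe] at h1
    refine h1.symm.trans ?_
    -- On words of degree-zero letters, `R ∘ φ` may be replaced by its truncation composed with the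
    -- linearizer, since `g` keeps values in degree zero. Associativity then cancels the linearizer
    -- against `g`.
    rw [LInfty.comp_congr (P := fun a => a.1 = 0) (P' := fun a => a.1 = 0) (f' := g)
      (h' := LInfty.comp (LInfty.truncateOne fun u => R (Φ u)) (LInfty.linearizer p S Φ))
      (fun s _ _ hs => ⟨rfl, LInfty.deg_eq_zero hs⟩)
      (fun u _ hu => (LInfty.comp_truncateOne_linearizer hp.idem hΦ.1 R hR hu).symm) hw,
      LInfty.comp_assoc hψ.isAdditive, hfg, LInfty.comp_idWord hψ hp.idem]
  refine ⟨A', F, G, hFG, B', hB', ?_, fun n hn a ha v hv => ?_⟩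
  -- In arity one only the linear part of `g` enters, and it is the identity on homogeneous vectors.
  · have h1 : ∀ x : M, B'.φ 1 (fun _ => x) = B.φ 1 fun _ => x := by
      have h2 : (MultilinearMap.ofSubsingleton K M (Module.End K V) (0 : Fin 1)).symm (B'.φ 1) =
          (MultilinearMap.ofSubsingleton K M (Module.End K V) (0 : Fin 1)).symm (B.φ 1) := by
        refine LinearMap.ext fun x => ?_
        induction x using DirectSum.Decomposition.inductionOn 𝓜 with
        | zero => simp only [map_zero]
        | add x y hx hy => rw [map_add, map_add, hx, hy]
        | homogeneous x =>
          rename_i k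
          have hx : (x : M) ∈ LInfty.shift 𝓜 (k - 1) := by simp [LInfty.shift]
          change B'.φ 1 (fun _ => (x : M)) = B.φ 1 fun _ => (x : M)
          rw [LInfty.apply_eq_evalWord hp.apply_of_mem B'.φ (d := fun _ => k - 1)
            (a := fun _ : Fin 1 => (x : M)) fun _ => hx, hφ', ← hΦ1 _ _ hx]
          simp [hΦdef, LInfty.comp_cons, hg.map_singleton, hp.apply_of_mem _ _ hx]
      exact fun x => LinearMap.congr_fun h2 x
    have h2 : B'.φ 1 = B.φ 1 := by
      ext1 a
      have : a = fun _ => a 0 := funext fun i => by rw [Subsingleton.elim i 0]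
      rw [this, h1]
    unfold LInfty.LModule.m
    rw [h2]
  -- The décalage signs are trivial on `M^1`, which has degree zero in `M[1]`.
  · have hs : ∀ (k : ℕ) i, (LInfty.signOp 𝓜 ^ k) (a i) = a i := by
      intro k i
      induction k with
      | zero => rfl
      | succ k ih =>
        rw [pow_succ, Module.End.mul_apply, LInfty.signOp_of_mem 𝓜 (ha i)]
        simpa using ih
    have h1 : B'.φ n a v = 0 := by
      have hhom : LInfty.IsHomog (LInfty.shift 𝓜) (fun _ => 0) a := fun i => by
        simpa [LInfty.shift] using ha i
      rw [LInfty.apply_eq_evalWord hp.apply_of_mem B'.φ hhom]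
      have h2 := hlin (List.ofFn fun i => (0, a i)) (by simp [List.mem_ofFn'])
      rw [LInfty.truncateOne, if_neg (by simp; omega)] at h2
      exact LinearMap.congr_fun h2 ⟨v, hv⟩
    simp only [LInfty.LModule.m, neg_apply, MultilinearMap.compLinearMap_apply, hs,
      LinearMap.neg_apply, h1, neg_zero]
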